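/- Let $n=2m\ge 2$ be even, let $(M,g)$ be an oriented Riemannian manifold of dimension $n$ with Levi-Civita connection $\nabla^T$, and let $e=(e_1,\dots,e_n)$ be an oriented orthonormal frame on an open set $U\subset M$. Put $R_T(X,Y)=\nabla^2_{X,Y}-\nabla^2_{Y,X}$ with $\nabla^2_{X,Y}=\nabla_X\nabla_Y-\nabla_{\nabla^T_XY}$, $R_{ijkl}=g(R_T(e_i,e_j)e_k,e_l)$, $R_{ij}=\sum_kR_{ikkj}$, $\kappa=\sum_iR_{ii}$, and $$S_{ijkl}=\tfrac{\kappa}{n(n-1)}(\delta_{il}\delta_{jk}-\delta_{ik}\delta_{jl}),\quad E_{ij}=\tfrac1{n-2}\bigl(\tfrac{\kappa}{n}\delta_{ij}-R_{ij}\bigr),$$ $$K_{ijkl}=E_{ik}\delta_{jl}+E_{jl}\delta_{ik}-E_{il}\delta_{jk}-E_{jk}\delta_{il},\quad W_{ijkl}=R_{ijkl}-K_{ijkl}-S_{ijkl}$$ (for $n=2$ put $E=0$); $W$ is the Weyl tensor and $E$ the Einstein (trace-free Ricci) tensor. Let $e_{ij}\in\mathfrak{so}(n)$ be the endomorphism $u\mapsto\langle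 e_i,u\rangle e_j-\langle e_j,u\rangle e_i$ of $\mathbb R^n$ with standard basis $e_1,\dots,e_n$. In the enveloping algebra $U(\mathfrak{so}(n,\mathbb C))$ put $$\mathrm{pf}=\frac{1}{(\sqrt{-1})^m2^mm!}\sum_{\sigma\in\mathfrak S_{2m}}\mathrm{sgn}(\sigma)\,e_{\sigma(1)\sigma(2)}\cdots e_{\sigma(2m-1)\sigma(2m)},$$ $\mathrm{pf}_{ii}=\mathrm{pf}$, and for $i<j$, with $a_1<\dots<a_{2m-2}$ the elements of $\{1,\dots,2m\}\setminus\{i,j\}$, $$\mathrm{pf}_{ij}=(-1)^{i+j}\frac{2m}{(\sqrt{-1})^m2^mm!}\sum_{\sigma}\mathrm{sgn}(\sigma)\,e_{\sigma(a_1)\sigma(a_2)}\cdots e_{\sigma(a_{2m-3})\sigma(a_{2m-2})},\qquad \mathrm{pf}_{ji}=-\mathrm{pf}_{ij},$$ where $\sigma$ runs over the permutations of $\{a_1,\dots,a_{2m-2}\}$. Let $(\pi_\rho,V_\rho)$ be a finite-dimensional complex representation of $\mathfrak{so}(n)$ (for example the irreducible one with highest weight $\rho$), extended to $U(\mathfrak{so}(n,\mathbb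 C))$. If it comes from a representation of $SO(n)$, let $\mathbf S_\rho=\mathbf{SO}(M)\times_{SO(n)}V_\rho$ be the associated bundle, where $\mathbf{SO}(M)$ is the bundle of oriented orthonormal frames; in the trivialization of $\mathbf S_\rho$ over $U$ given by $e$, sections are functions $\psi:U\to V_\rho$ and the covariant derivative is $\nabla=d+\frac12\sum_{ij}g(\nabla^Te_i,e_j)\pi_\rho(e_{ij})$. (In general, consider functions $\psi:U\to V_\rho$ with this covariant derivative, as for bundles associated to a spin structure.) Let $R_\rho(X,Y)=\nabla^2_{X,Y}-\nabla^2_{Y,X}$ be its curvature and, with $\pi_\rho(a)$ acting on the fibres through the trivialization, let $$R^{\mathrm{pf}}_\rho=\sum_{ij}\pi_\rho(\mathrm{pf}_{ij})R_\rho(e_i,e_j).$$ Then the part of $R^{\mathrm{pf}}_\rho$ that comes from the Einstein tensor vanishes, $\frac12\sum_{ijkl}K_{ijkl}\,\pi_\rho(\mathrm{pf}_{ij}e_{kl})=0$, and on smooth sections over $U$ $$R^{\mathrm{pf}}_\rho=\frac12\sum_{ijkl}W_{ijkl}\,\pi_\rho(\mathrm{pf}_{ij}e_{kl})+\frac{\kappa}{n-1}\,\pi_\rho(\mathrm{pf}),$$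 so $R^{\mathrm{pf}}_\rho$ depends only on the Weyl tensor and the scalar curvature. -/

import Mathlib

open Bundle
open scoped Manifold ContDiff

attribute [local instance 100] LieRing.ofAssociativeRing

set_option linter.unusedSectionVars false

noncomputable section

namespace PfaffianCurvature

/-! ### The Lie algebra `𝔰𝔬(n, ℂ)` and the Pfaffian elements of its enveloping algebra -/

/-- `𝔰𝔬(n, ℂ)`: the complex skew-symmetric `n × n` matrices. -/
abbrev soC (n : ℕ) : LieSubalgebra ℂ (Matrix (Fin n) (Fin n) ℂ) :=
  LieAlgebra.Orthogonal.so (Fin n) ℂ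

/-- The enveloping algebra `U(𝔰𝔬(n, ℂ))`. -/
abbrev Uso (n : ℕ) : Type := UniversalEnvelopingAlgebra ℂ (soC n)

/-- `e_{ij} = e_i ∧ e_j`, the skew-symmetric endomorphism
`u ↦ ⟨e_i, u⟩ e_j - ⟨e_j, u⟩ e_i`, as a matrix (so `e_i ↦ e_j` and `e_j ↦ -e_i`). -/
def eLie (n : ℕ) (i j : Fin n) : soC n :=
  ⟨Matrix.single j i 1 - Matrix.single i j 1, by
    rw [LieAlgebra.Orthogonal.mem_so]; simp [Matrix.transpose_sub]⟩

/-- `e_{ij}` as an element of the enveloping algebra. -/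
def eU (n : ℕ) (i j : Fin n) : Uso n := UniversalEnvelopingAlgebra.ι ℂ (eLie n i j)

/-- `pf = 1 / (√-1^m 2^m m!) ∑_{σ ∈ 𝔖_{2m}} sgn(σ) e_{σ(1)σ(2)} ⋯ e_{σ(2m-1)σ(2m)}`. The indices
run over `0, …, 2m - 1` instead of `1, …, 2m`, and the product is taken in the displayed order. -/
def pf (m : ℕ) : Uso (2 * m) :=
  (1 / (Complex.I ^ m * 2 ^ m * (m.factorial : ℂ))) •
    ∑ σ : Equiv.Perm (Fin (2 * m)), ((Equiv.Perm.sign σ : ℤ) : ℂ) •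
      (List.ofFn fun k : Fin m =>
        eU (2 * m) (σ ⟨2 * k, by omega⟩) (σ ⟨2 * k + 1, by omega⟩)).prod

/-- The set of indices different from `i` and `j`. -/
abbrev Rest {m : ℕ} (i j : Fin (2 * m)) : Type := {l : Fin (2 * m) // l ≠ i ∧ l ≠ j}

theorem card_rest {m : ℕ} {i j : Fin (2 * m)} (h : i ≠ j) :
    Fintype.card (Rest i j) = 2 * (m - 1) := by
  have h2 : (Finset.univ.filter fun l : Fin (2 * m) => l ≠ i ∧ l ≠ j)
      = (Finset.univ.erase i).erase j := by
    ext l; simp [and_comm]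
  rw [Fintype.card_subtype, h2, Finset.card_erase_of_mem (by simp [h.symm]),
    Finset.card_erase_of_mem (by simp), Finset.card_univ, Fintype.card_fin]
  omega

/-- The increasing enumeration of the indices different from `i` and `j`. -/
def restEnum {m : ℕ} {i j : Fin (2 * m)} (h : i ≠ j) : Fin (2 * (m - 1)) ≃o Rest i j :=
  Fintype.orderIsoFinOfCardEq (Rest i j) (card_rest h)

/-- For `i ≠ j`, with `a_1 < ⋯ < a_{2m-2}` the indices different from `i` and `j`:
`(-1)^{i+j} 2m / (√-1^m 2^m m!) ∑_σ sgn(σ) e_{σ(a_1)σ(a_2)} ⋯ e_{σ(a_{2m-3})σ(a_{2m-2})}`,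
where `σ` runs over the permutations of `{a_1, …, a_{2m-2}}`. -/
def pfAux (m : ℕ) {i j : Fin (2 * m)} (h : i ≠ j) : Uso (2 * m) :=
  ((-1 : ℂ) ^ ((i : ℕ) + (j : ℕ)) * (2 * (m : ℂ))
      / (Complex.I ^ m * 2 ^ m * (m.factorial : ℂ))) •
    ∑ σ : Equiv.Perm (Rest i j), ((Equiv.Perm.sign σ : ℤ) : ℂ) •
      (List.ofFn fun k : Fin (m - 1) =>
        eU (2 * m) (σ (restEnum h ⟨2 * k, by omega⟩)).1
          (σ (restEnum h ⟨2 * k + 1, by omega⟩)).1).prod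

/-- `pf_{ij}`: equal to `pf` for `i = j`, to `pfAux` for `i < j`, and to `-pf_{ji}` for `i > j`. -/
def pfIJ (m : ℕ) (i j : Fin (2 * m)) : Uso (2 * m) :=
  if h : i = j then pf m
  else if i < j then pfAux m h
  else -pfAux m (Ne.symm h)

section Rep

variable {n : ℕ} {V : Type*} [AddCommGroup V] [Module ℂ V]

/-- The extension of a representation `ρ` of `𝔰𝔬(n)` to the enveloping algebra. -/
def repU (ρ : soC n →ₗ⁅ℂ⁆ Module.End ℂ V) : Uso n →ₐ[ℂ] Module.End ℂ V :=
  UniversalEnvelopingAlgebra.lift ℂ ρ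

end Rep

/-! ### Decomposition of the components of a curvature tensor -/

section Decomposition

variable {n : ℕ} (R : Fin n → Fin n → Fin n → Fin n → ℝ)

/-- Kronecker delta. -/
def kd (i j : Fin n) : ℝ := if i = j then 1 else 0

/-- `R_{ij} = ∑_k R_{ikkj}`. -/
def ricci (i j : Fin n) : ℝ := ∑ k, R i k k j

/-- `κ = ∑_i R_{ii}`. -/
def scal : ℝ := ∑ i, ricci R i i

/-- `S_{ijkl} = κ / (n(n-1)) (δ_{il} δ_{jk} - δ_{ik} δ_{jl})`. -/
def scalPart (i j k l : Fin n) : ℝ :=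
  scal R / ((n : ℝ) * ((n : ℝ) - 1)) * (kd i l * kd j k - kd i k * kd j l)

/-- The Einstein tensor `E_{ij} = 1 / (n-2) (κ/n δ_{ij} - R_{ij})`. For `n = 2` the bracket vanishes
for every Riemannian curvature tensor, and then `E = 0` here, whatever `R` is. -/
def einstein (i j : Fin n) : ℝ :=
  1 / ((n : ℝ) - 2) * (scal R / (n : ℝ) * kd i j - ricci R i j)

/-- `K_{ijkl} = E_{ik} δ_{jl} + E_{jl} δ_{ik} - E_{il} δ_{jk} - E_{jk} δ_{il}`. -/
def einsteinPart (i j k l : Fin n) : ℝ :=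
  einstein R i k * kd j l + einstein R j l * kd i k
    - einstein R i l * kd j k - einstein R j k * kd i l

/-- The conformal Weyl tensor `W = R - K - S`. -/
def weyl (i j k l : Fin n) : ℝ := R i j k l - einsteinPart R i j k l - scalPart R i j k l

end Decomposition

/-! ### Second covariant derivatives and curvature -/

section Curvature

variable {n : ℕ} {M : Type*} [TopologicalSpace M] [ChartedSpace (EuclideanSpace ℝ (Fin n)) M]
  [IsManifold (𝓡 n) ∞ M]
  {S : M → Type*} [∀ x, AddCommGroup (S x)]

/-- `∇²_{X,Y} = ∇_X ∇_Y - ∇_{∇^T_X Y}` for an operator `D` on sections of `S`, where `D σ x v`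
stands for `(∇_v σ)(x)`, and for a connection `cov` on the tangent bundle. -/
def nabla2 (cov : CovariantDerivative (𝓡 n) (EuclideanSpace ℝ (Fin n))
      (fun x : M => TangentSpace (𝓡 n) x))
    (D : (Π x : M, S x) → Π x : M, TangentSpace (𝓡 n) x → S x)
    (X Y : Π x : M, TangentSpace (𝓡 n) x) (σ : Π x : M, S x) (x : M) : S x :=
  D (fun y => D σ y (Y y)) x (X x) - D σ x (cov Y x (X x))

/-- The curvature `R(X, Y) = ∇²_{X,Y} - ∇²_{Y,X}`. -/
def curv (cov : CovariantDerivative (𝓡 n) (EuclideanSpace ℝ (Fin n))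
      (fun x : M => TangentSpace (𝓡 n) x))
    (D : (Π x : M, S x) → Π x : M, TangentSpace (𝓡 n) x → S x)
    (X Y : Π x : M, TangentSpace (𝓡 n) x) (σ : Π x : M, S x) (x : M) : S x :=
  nabla2 cov D X Y σ x - nabla2 cov D Y X σ x

/-- The curvature `R_T` of a connection on the tangent bundle. -/
def curvT (cov : CovariantDerivative (𝓡 n) (EuclideanSpace ℝ (Fin n))
      (fun x : M => TangentSpace (𝓡 n) x))
    (X Y Z : Π x : M, TangentSpace (𝓡 n) x) (x : M) : TangentSpace (𝓡 n) x :=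
  curv (S := fun x : M => TangentSpace (𝓡 n) x) cov (fun Z y v => cov Z y v) X Y Z x

end Curvature

/-! ### Oriented Riemannian manifolds and their frames -/

section Frames

variable {n : ℕ} {M : Type*} [TopologicalSpace M] [ChartedSpace (EuclideanSpace ℝ (Fin n)) M]
  [IsManifold (𝓡 n) ∞ M]

/-- The vector field `X` is smooth on `U`. -/
def SmoothFieldOn (X : Π x : M, TangentSpace (𝓡 n) x) (U : Set M) : Prop :=
  ContMDiffOn (𝓡 n) (𝓡 n).tangent ∞
    (fun x => (⟨x, X x⟩ : TangentBundle (𝓡 n) M)) U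

/-- A family of orientations of the tangent spaces is an orientation of the manifold if every point
has an open neighbourhood with a smooth positively oriented frame. -/
def IsManifoldOrientation (o : ∀ x : M, Orientation ℝ (TangentSpace (𝓡 n) x) (Fin n)) : Prop :=
  ∀ x₀ : M, ∃ U : Set M, IsOpen U ∧ x₀ ∈ U ∧
    ∃ b : ∀ x : M, Module.Basis (Fin n) ℝ (TangentSpace (𝓡 n) x),
      (∀ i, SmoothFieldOn (fun x => b x i) U) ∧ ∀ x ∈ U, (b x).orientation = o x

variable [RiemannianBundle (fun x : M => TangentSpace (𝓡 n) x)]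

/-- The fibre at `x` of the bundle `SO(M)` of oriented orthonormal frames. -/
structure OFrame (o : ∀ x : M, Orientation ℝ (TangentSpace (𝓡 n) x) (Fin n)) (x : M) where
  /-- the orthonormal basis `(e_1, …, e_n)` of the tangent space -/
  basis : OrthonormalBasis (Fin n) ℝ (TangentSpace (𝓡 n) x)
  oriented : basis.toBasis.orientation = o x

variable {o : ∀ x : M, Orientation ℝ (TangentSpace (𝓡 n) x) (Fin n)}

/-- The `i`-th vector field of a family of frames. -/
def vec (e : ∀ x : M, OFrame o x) (i : Fin n) : Π x : M, TangentSpace (𝓡 n) x :=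
  fun x => (e x).basis i

/-- A family of frames is a local section of `SO(M)` over `U` if its vector fields are smooth
on `U`. Its values outside `U` play no role. -/
def IsLocalFrame (e : ∀ x : M, OFrame o x) (U : Set M) : Prop :=
  ∀ i, SmoothFieldOn (vec e i) U

/-- `R_{ijkl} = g(R_T(e_i, e_j) e_k, e_l)` at the point `x`. -/
def riem (cov : CovariantDerivative (𝓡 n) (EuclideanSpace ℝ (Fin n))
      (fun x : M => TangentSpace (𝓡 n) x))
    (e : ∀ x : M, OFrame o x) (x : M) (i j k l : Fin n) : ℝ :=
  inner ℝ (curvT cov (vec e i) (vec e j) (vec e k) x) (vec e l x)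

instance riemannianBundle_one
    [IsContMDiffRiemannianBundle (𝓡 n) ∞ (EuclideanSpace ℝ (Fin n))
      (fun x : M => TangentSpace (𝓡 n) x)] :
    IsContMDiffRiemannianBundle (𝓡 n) 1 (EuclideanSpace ℝ (Fin n))
      (fun x : M => TangentSpace (𝓡 n) x) :=
  IsContMDiffRiemannianBundle.of_le (n := ∞) (by simp)

/-- `cov` is the Levi-Civita connection: the smooth connection on the tangent bundle that is metric
and has no torsion. -/
structure IsLeviCivita
    [IsContMDiffRiemannianBundle (𝓡 n) ∞ (EuclideanSpace ℝ (Fin n))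
      (fun x : M => TangentSpace (𝓡 n) x)]
    (cov : CovariantDerivative (𝓡 n) (EuclideanSpace ℝ (Fin n))
      (fun x : M => TangentSpace (𝓡 n) x)) : Prop where
  smooth : cov.ContMDiffCovariantDerivative ∞
  metric : cov.IsMetricCompatible
  torsion_free : cov.torsion = 0

/-- The covariant derivative `∇ = d + ½ ∑_{ij} g(∇^T e_i, e_j) ρ(e_{ij})`, in the local
trivialization given by the frame `e`, applied to the section with coordinate function `ψ`, at the
point `x` in the direction `v`. -/
def localConn {V : Type*} [NormedAddCommGroup V] [NormedSpace ℂ V]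
    (cov : CovariantDerivative (𝓡 n) (EuclideanSpace ℝ (Fin n))
      (fun x : M => TangentSpace (𝓡 n) x))
    (e : ∀ x : M, OFrame o x) (ρ : soC n →ₗ⁅ℂ⁆ Module.End ℂ V)
    (ψ : M → V) (x : M) (v : TangentSpace (𝓡 n) x) : V :=
  mvfderiv (𝓡 n) ψ x v
    + (1 / 2 : ℂ) • ∑ i, ∑ j,
      ((inner ℝ (cov (vec e i) x v) (vec e j x) : ℝ) : ℂ) • ρ (eLie n i j) (ψ x)

/-! ### The associated bundle `SO(M) ×_{SO(n)} V` -/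

/-- The group `SO(n)`. -/
abbrev SOn (n : ℕ) : Type := Matrix.specialOrthogonalGroup (Fin n) ℝ

/-- `q = p · g` for the right action of `SO(n)` on frames: `q_j = ∑_i g_{ij} p_i`. -/
def IsTranslate {x : M} (p : OFrame o x) (g : SOn n) (q : OFrame o x) : Prop :=
  ∀ j, q.basis j = ∑ i, g.1 i j • p.basis i

/-- The element `g` of `SO(n)` with `q = p · g`. -/
def transition {x : M} (p q : OFrame o x) : SOn n :=
  ⟨p.basis.toBasis.toMatrix q.basis, by
    rw [Matrix.mem_specialOrthogonalGroup_iff]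
    refine ⟨?_, ?_⟩
    · exact OrthonormalBasis.toMatrix_orthonormalBasis_mem_orthogonal _ _
    · have h := p.basis.det_to_matrix_orthonormalBasis_of_same_orientation q.basis
        (p.oriented.trans q.oriented.symm)
      rwa [Module.Basis.det_apply] at h⟩

theorem isTranslate_transition {x : M} (p q : OFrame o x) :
    IsTranslate p (transition p q) q := by
  intro j
  exact (p.basis.toBasis.sum_toMatrix_smul_self (fun j => q.basis j) j).symm.trans
    (by simp [transition])

theorem IsTranslate.unique {x : M} {p q : OFrame o x} {g : SOn n} (h : IsTranslate p g q) :
    g = transition p q := by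
  apply Subtype.ext
  ext i j
  have h1 := h j
  have : q.basis j = ∑ i, (transition p q).1 i j • p.basis i := isTranslate_transition p q j
  rw [h1] at this
  have hl := p.basis.toBasis.linearIndependent
  rw [Fintype.linearIndependent_iff] at hl
  have h2 := hl (fun i => g.1 i j - (transition p q).1 i j) (by
    simp only [sub_smul, Finset.sum_sub_distrib, OrthonormalBasis.coe_toBasis]
    rw [this, sub_self]) i
  exact sub_eq_zero.mp h2

theorem IsTranslate.trans {x : M} {p q r : OFrame o x} {g h : SOn n}
    (h1 : IsTranslate p g q) (h2 : IsTranslate q h r) : IsTranslate p (g * h) r := by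
  intro j
  rw [h2 j]
  simp only [h1 _, Finset.smul_sum, smul_smul]
  rw [Finset.sum_comm]
  refine Finset.sum_congr rfl fun i _ => ?_
  rw [← Finset.sum_smul]
  congr 1
  simp [Matrix.mul_apply, mul_comm]

variable {V : Type*} [NormedAddCommGroup V] [NormedSpace ℂ V]

/-- The fibre at `x` of the associated bundle `S = SO(M) ×_{SO(n)} V`, whose elements are written
as the equivariant maps `f : SO(M)_x → V`, `f (p · g) = Φ(g)⁻¹ f(p)`. The class `[p, φ]` is the map
`f` with `f p = φ`. -/
def Fibre (o : ∀ x : M, Orientation ℝ (TangentSpace (𝓡 n) x) (Fin n))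
    (Φ : Representation ℂ (SOn n) V) (x : M) : Submodule ℂ (OFrame o x → V) where
  carrier := {f | ∀ p q g, IsTranslate p g q → f p = Φ g (f q)}
  add_mem' := by
    intro a b ha hb p q g h
    simp [ha p q g h, hb p q g h]
  zero_mem' := by
    intro p q g _
    simp
  smul_mem' := by
    intro c a ha p q g h
    simp [ha p q g h]

/-- The linear isomorphism `[p, φ] ↦ φ` from the fibre to `V` given by a frame `p`. -/
def frameEquiv (Φ : Representation ℂ (SOn n) V) {x : M} (p : OFrame o x) :
    Fibre o Φ x ≃ₗ[ℂ] V where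
  toFun f := f.1 p
  map_add' _ _ := rfl
  map_smul' _ _ := rfl
  invFun v := ⟨fun q => Φ (transition q p) v, by
    intro q r g h
    have := (h.trans (isTranslate_transition r p)).unique
    show Φ (transition q p) v = Φ g (Φ (transition r p) v)
    rw [← this, map_mul]
    rfl⟩
  left_inv f := by
    apply Subtype.ext
    funext q
    exact (f.2 q p _ (isTranslate_transition q p)).symm
  right_inv v := by
    have h : IsTranslate p 1 p := by
      intro j
      simp [Matrix.one_apply]
    show Φ (transition p p) v = v
    rw [← h.unique, map_one]
    rfl

/-- The coordinate function `ψ` of a section `σ = [e, ψ]` with respect to a frame `e`. -/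
def coord (Φ : Representation ℂ (SOn n) V) (e : ∀ x : M, OFrame o x)
    (σ : Π x : M, Fibre o Φ x) : M → V :=
  fun x => frameEquiv Φ (e x) (σ x)

/-- The endomorphism `[e, φ] ↦ [e, ρ(a) φ]` of the fibre at `x`, for `a` in the enveloping
algebra. -/
def act (Φ : Representation ℂ (SOn n) V) (ρ : soC n →ₗ⁅ℂ⁆ Module.End ℂ V)
    (e : ∀ x : M, OFrame o x) (x : M) (a : Uso n) : Module.End ℂ (Fibre o Φ x) :=
  (frameEquiv Φ (e x)).symm.conj (repU ρ a)

/-- `ρ` is the differential at the identity of the representation `Φ` of `SO(n)`: for every curve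
`γ` in `SO(n)` through `1` with velocity `B` at time `0`, the derivative of `Φ(γ(t)) v` at `0` is
`ρ(B) v`. -/
def IsDifferential (Φ : Representation ℂ (SOn n) V)
    (ρ : soC n →ₗ⁅ℂ⁆ Module.End ℂ V) : Prop :=
  ∀ (B : soC n) (γ : ℝ → SOn n), γ 0 = 1 →
    (∀ i j, HasDerivAt (fun t : ℝ => (((γ t).1 i j : ℝ) : ℂ)) (B.1 i j) 0) →
    ∀ v : V, HasDerivAt (fun t : ℝ => Φ (γ t) v) (ρ B v) 0

/-- `D` is the covariant derivative on `S = SO(M) ×_{SO(n)} V` induced by the connection `cov`: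
in the trivialization given by any local frame it is given by `localConn`. Here `D σ x v`
stands for `(∇_v σ)(x)`. -/
def IsInducedConnection
    (cov : CovariantDerivative (𝓡 n) (EuclideanSpace ℝ (Fin n))
      (fun x : M => TangentSpace (𝓡 n) x))
    (Φ : Representation ℂ (SOn n) V) (ρ : soC n →ₗ⁅ℂ⁆ Module.End ℂ V)
    (D : (Π x : M, Fibre o Φ x) → Π x : M, TangentSpace (𝓡 n) x → Fibre o Φ x) : Prop :=
  ∀ (e : ∀ x : M, OFrame o x) (U : Set M), IsOpen U → IsLocalFrame e U →
    ∀ (σ : Π x : M, Fibre o Φ x), ∀ x ∈ U,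
      MDifferentiableAt (𝓡 n) 𝓘(ℝ, V) (coord Φ e σ) x →
      ∀ v : TangentSpace (𝓡 n) x,
        frameEquiv Φ (e x) (D σ x v) = localConn cov e ρ (coord Φ e σ) x v

end Frames

/-! ### The Pfaffian curvature endomorphism -/

section Pfaffian

variable {m : ℕ} {M : Type*} [TopologicalSpace M]
  [ChartedSpace (EuclideanSpace ℝ (Fin (2 * m))) M] [IsManifold (𝓡 (2 * m)) ∞ M]
  [RiemannianBundle (fun x : M => TangentSpace (𝓡 (2 * m)) x)]
  {o : ∀ x : M, Orientation ℝ (TangentSpace (𝓡 (2 * m)) x) (Fin (2 * m))}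
  {V : Type*} [NormedAddCommGroup V] [NormedSpace ℂ V]

/-- `R^pf σ = ∑_{ij} ρ(pf_{ij}) R(e_i, e_j) σ` at the point `x`, in the trivialization given by the
frame `e`; `σ` is given by its coordinate function `ψ`. -/
def localRpf
    (cov : CovariantDerivative (𝓡 (2 * m)) (EuclideanSpace ℝ (Fin (2 * m)))
      (fun x : M => TangentSpace (𝓡 (2 * m)) x))
    (e : ∀ x : M, OFrame o x) (ρ : soC (2 * m) →ₗ⁅ℂ⁆ Module.End ℂ V)
    (ψ : M → V) (x : M) : V :=
  ∑ i, ∑ j, repU ρ (pfIJ m i j)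
    (curv (S := fun _ : M => V) cov (localConn cov e ρ) (vec e i) (vec e j) ψ x)

/-- `R^pf σ = ∑_{ij} ρ(pf_{ij}) R(e_i, e_j) σ` at the point `x`, for a section `σ` of the associated
bundle and the curvature `R` of the operator `D` on sections. -/
def bundleRpf
    (cov : CovariantDerivative (𝓡 (2 * m)) (EuclideanSpace ℝ (Fin (2 * m)))
      (fun x : M => TangentSpace (𝓡 (2 * m)) x))
    (e : ∀ x : M, OFrame o x) (Φ : Representation ℂ (SOn (2 * m)) V)
    (ρ : soC (2 * m) →ₗ⁅ℂ⁆ Module.End ℂ V)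
    (D : (Π x : M, Fibre o Φ x) → Π x : M, TangentSpace (𝓡 (2 * m)) x → Fibre o Φ x)
    (σ : Π x : M, Fibre o Φ x) (x : M) : Fibre o Φ x :=
  ∑ i, ∑ j, act Φ ρ e x (pfIJ m i j)
    (curv (S := fun y : M => Fibre o Φ y) cov D (vec e i) (vec e j) σ x)

/-- `½ ∑_{ijkl} A_{ijkl} pf_{ij} e_{kl}` in the enveloping algebra. -/
def pfContract (m : ℕ)
    (A : Fin (2 * m) → Fin (2 * m) → Fin (2 * m) → Fin (2 * m) → ℝ) : Uso (2 * m) :=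
  (1 / 2 : ℂ) • ∑ i, ∑ j, ∑ k, ∑ l, ((A i j k l : ℝ) : ℂ) • (pfIJ m i j * eU (2 * m) k l)

end Pfaffian

end PfaffianCurvature

end

/-! In an orthonormal frame the curvature of the induced connection is `R_ρ(e_i, e_j) = ½ ∑_{kl}
R_{ijkl} ρ(e_{kl})` (`curv_localConn`), so `R^pf` is the image under `ρ` of `½ ∑ R_{ijkl} pf_{ij}
e_{kl}`. This contraction is linear in `R = W + K + S`, and what remains is algebra in the
enveloping algebra.

Everything rests on the elements `P_{ik} = ∑_{j≠i} pf_{ij} e_{kj}` (`pfRow`). The terms of `K` and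
`S` contain Kronecker deltas, so their contractions collapse to `∑ E_{ik} P_{ik}` and to a multiple
of `∑_i P_{ii}`. Expanding the Pfaffian along a row gives `P_{ii} = -pf` for every `i`
(`pfRow_self`), and `P_{ki} = -P_{ik}` for `i ≠ k` (`pfRow_swap`). As `E` is symmetric and
trace-free, the off-diagonal terms cancel in pairs and the diagonal gives `-tr(E) pf = 0`.

The skew-symmetry of `P` is the noncommutative form of "a Pfaffian with a repeated row vanishes".
With commuting entries `P_{ik}` would be zero. Here a product `e_{kb} e_{ka}`, antisymmetrized in
`a` and `b`, leaves half the commutator `e_{ba}`, which no longer contains `k`. The result depends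
on `i` and `k` only through the positions they occupy in an alternating sum, and therefore changes
sign when they are exchanged (`crossSum_swap`).

On the geometric side, the structure equation (`riem_eq`) identifies the curvature, and the first
Bianchi identity makes the Ricci tensor, hence `E`, symmetric. -/

namespace PfaffianCurvature

/-! ### Relations in the enveloping algebra -/

section Relations

variable {n : ℕ}

theorem eLie_swap (i j : Fin n) : eLie n j i = -eLie n i j := by
  apply Subtype.ext
  simp [eLie]

theorem eLie_self (i : Fin n) : eLie n i i = 0 := by
  apply Subtype.ext
  simp [eLie]

theorem eU_swap (i j : Fin n) : eU n j i = -eU n i j := by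
  rw [eU, eU, eLie_swap i j, map_neg]

theorem eU_self (i : Fin n) : eU n i i = 0 := by
  rw [eU, eLie_self, map_zero]

theorem lie_eLie_of_disjoint {i j k l : Fin n} (hik : i ≠ k) (hil : i ≠ l) (hjk : j ≠ k)
    (hjl : j ≠ l) : ⁅eLie n i j, eLie n k l⁆ = 0 := by
  apply Subtype.ext
  rw [LieSubalgebra.coe_bracket]
  simp [eLie, LieRing.of_associative_ring_bracket, mul_sub, sub_mul, hik, hil, hjk, hjl, hik.symm,
    hil.symm, hjk.symm, hjl.symm]

theorem lie_eLie_common {k a b : Fin n} (hka : k ≠ a) (hkb : k ≠ b) (hab : a ≠ b) :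
    ⁅eLie n k a, eLie n k b⁆ = eLie n a b := by
  apply Subtype.ext
  rw [LieSubalgebra.coe_bracket]
  simp [eLie, LieRing.of_associative_ring_bracket, mul_sub, sub_mul, hka, hkb, hab, hka.symm,
    hkb.symm, hab.symm]
  abel

theorem eU_mul_sub (i j k l : Fin n) :
    eU n i j * eU n k l - eU n k l * eU n i j
      = UniversalEnvelopingAlgebra.ι ℂ ⁅eLie n i j, eLie n k l⁆ := by
  rw [LieHom.map_lie, LieRing.of_associative_ring_bracket]
  rfl

theorem commute_eU {i j k l : Fin n} (hik : i ≠ k) (hil : i ≠ l) (hjk : j ≠ k) (hjl : j ≠ l) :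
    Commute (eU n i j) (eU n k l) := by
  have h := eU_mul_sub i j k l
  rw [lie_eLie_of_disjoint hik hil hjk hjl, map_zero] at h
  exact sub_eq_zero.mp h

theorem eU_commutator {k a b : Fin n} (hka : k ≠ a) (hkb : k ≠ b) (hab : a ≠ b) :
    eU n k a * eU n k b - eU n k b * eU n k a = eU n a b := by
  rw [eU_mul_sub, lie_eLie_common hka hkb hab]
  rfl

end Relations

/-! ### Alternating sums over bijective labellings -/

section AltSum

/-- Pairing of the positions `0, …, 2m - 1` into `m` blocks of two. -/
def slotEquiv (m : ℕ) : Fin m × Fin 2 ≃ Fin (2 * m) :=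
  finProdFinEquiv.trans (finCongr (mul_comm m 2))

theorem slotEquiv_zero {m : ℕ} (k : Fin m) : slotEquiv m (k, 0) = ⟨2 * k, by omega⟩ := by
  ext
  simp [slotEquiv]

theorem slotEquiv_one {m : ℕ} (k : Fin m) : slotEquiv m (k, 1) = ⟨2 * k + 1, by omega⟩ := by
  ext
  simp [slotEquiv, add_comm]

variable {m : ℕ} {A : Type*} [AddCommGroup A] [Module ℂ A]

/-- The alternating sum of `f` over all bijective labellings of `m` blocks of two positions. -/
def altSum (f : (Fin m × Fin 2 → Fin (2 * m)) → A) : A :=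
  ∑ σ : Equiv.Perm (Fin (2 * m)), ((Equiv.Perm.sign σ : ℤ) : ℂ) • f (σ ∘ slotEquiv m)

/-- Reindexing by right multiplication with `τ`, transported to the positions. All later symmetries
are the cases of a transposition (sign `-1`) and of a permutation of whole blocks (sign `1`). -/
theorem altSum_comp (τ : Equiv.Perm (Fin m × Fin 2)) (f : (Fin m × Fin 2 → Fin (2 * m)) → A) :
    altSum (fun s => f (s ∘ τ)) = ((Equiv.Perm.sign τ : ℤ) : ℂ) • altSum f := by
  unfold altSum
  rw [Finset.smul_sum]
  refine Fintype.sum_equiv (Equiv.mulRight ((slotEquiv m).permCongr τ)) _ _ fun σ => ?_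
  have h1 : (σ ∘ slotEquiv m) ∘ τ = (σ * (slotEquiv m).permCongr τ) ∘ slotEquiv m := by
    funext q
    simp
  have h2 : ((Equiv.Perm.sign τ : ℤ) : ℂ) * ((Equiv.Perm.sign τ : ℤ) : ℂ) = 1 := by
    rw [← Int.cast_mul, ← Units.val_mul, Int.units_mul_self]
    simp
  simp only [Equiv.coe_mulRight, h1]
  rw [Equiv.Perm.sign_mul, Equiv.Perm.sign_permCongr, smul_smul, Units.val_mul, Int.cast_mul,
    mul_left_comm, h2, mul_one]

theorem altSum_congr {f g : (Fin m × Fin 2 → Fin (2 * m)) → A}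
    (h : ∀ s, Function.Bijective s → f s = g s) : altSum f = altSum g := by
  refine Finset.sum_congr rfl fun σ _ => ?_
  rw [h _ (σ.bijective.comp (slotEquiv m).bijective)]

theorem altSum_eq_zero {f : (Fin m × Fin 2 → Fin (2 * m)) → A}
    (h : ∀ s, Function.Bijective s → f s = 0) : altSum f = 0 := by
  rw [altSum_congr h]
  simp [altSum]

theorem altSum_add (f g : (Fin m × Fin 2 → Fin (2 * m)) → A) :
    altSum (fun s => f s + g s) = altSum f + altSum g := by
  simp [altSum, Finset.sum_add_distrib]

theorem altSum_neg (f : (Fin m × Fin 2 → Fin (2 * m)) → A) :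
    altSum (fun s => -f s) = -altSum f := by
  simp [altSum, Finset.sum_neg_distrib]

theorem altSum_sum {κ : Type*} (t : Finset κ) (f : κ → (Fin m × Fin 2 → Fin (2 * m)) → A) :
    altSum (fun s => ∑ k ∈ t, f k s) = ∑ k ∈ t, altSum (f k) := by
  simp only [altSum, Finset.smul_sum]
  rw [Finset.sum_comm]

theorem altSum_mul_right {n : ℕ} (f : (Fin m × Fin 2 → Fin (2 * m)) → Uso n) (a : Uso n) :
    altSum (fun s => f s * a) = altSum f * a := by
  simp [altSum, Finset.sum_mul]

/-- An alternating sum is the sum over all positions `q` of the parts in which `q` has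
label `i`. -/
theorem altSum_eq_sum_slots (i : Fin (2 * m)) (f : (Fin m × Fin 2 → Fin (2 * m)) → A) :
    altSum f = ∑ q, altSum (fun s => if s q = i then f s else 0) := by
  rw [← altSum_sum]
  refine altSum_congr fun s hs => ?_
  obtain ⟨q, rfl⟩ := hs.2 i
  rw [Finset.sum_eq_single q]
  · simp
  · intro q' _ hq'
    rw [if_neg fun h => hq' (hs.1 h)]
  · simp

/-- A permutation of the blocks, as a permutation of the positions. -/
abbrev blockPerm (β : Equiv.Perm (Fin m)) : Equiv.Perm (Fin m × Fin 2) :=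
  Equiv.prodCongrLeft fun _ => β

/-- `β` acts once on the first positions and once on the second positions of the blocks, so its sign
enters squared. -/
theorem sign_blockPerm (β : Equiv.Perm (Fin m)) : Equiv.Perm.sign (blockPerm β) = 1 := by
  rw [Equiv.Perm.sign_prodCongrLeft]
  simp

theorem altSum_comp_blockPerm (β : Equiv.Perm (Fin m)) (f : (Fin m × Fin 2 → Fin (2 * m)) → A) :
    altSum (fun s => f (s ∘ blockPerm β)) = altSum f := by
  rw [altSum_comp, sign_blockPerm]
  simp

theorem altSum_comp_swap {p q : Fin m × Fin 2} (h : p ≠ q)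
    (f : (Fin m × Fin 2 → Fin (2 * m)) → A) :
    altSum (fun s => f (s ∘ Equiv.swap p q)) = -altSum f := by
  rw [altSum_comp, Equiv.Perm.sign_swap h]
  simp

end AltSum

/-! ### Products of pairs -/

section PairProd

variable {n : ℕ}

/-- The product `e_{s(0,0)s(0,1)} e_{s(1,0)s(1,1)} ⋯` over all blocks of a labelling. -/
def pairProd {k : ℕ} (s : Fin k × Fin 2 → Fin n) : Uso n :=
  (List.ofFn fun l => eU n (s (l, 0)) (s (l, 1))).prod

/-- The labelling of all blocks but the first. -/
def tailBlocks {k : ℕ} (s : Fin (k + 1) × Fin 2 → Fin n) : Fin k × Fin 2 → Fin n :=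
  fun q => s (q.1.succ, q.2)

theorem pairProd_succ {k : ℕ} (s : Fin (k + 1) × Fin 2 → Fin n) :
    pairProd s = eU n (s (0, 0)) (s (0, 1)) * pairProd (tailBlocks s) := by
  simp [pairProd, tailBlocks, List.ofFn_succ]

theorem tailBlocks_injective {k : ℕ} {s : Fin (k + 1) × Fin 2 → Fin n}
    (hs : Function.Injective s) : Function.Injective (tailBlocks s) := by
  intro p q h
  have := hs h
  simpa [Prod.ext_iff] using this

theorem tailBlocks_comp_swap {k : ℕ} (s : Fin (k + 1) × Fin 2 → Fin n) {p q : Fin (k + 1) × Fin 2}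
    (hp : p.1 = 0) (hq : q.1 = 0) : tailBlocks (s ∘ Equiv.swap p q) = tailBlocks s := by
  funext r
  simp only [tailBlocks, Function.comp_apply]
  rw [Equiv.swap_apply_of_ne_of_ne]
  · rintro rfl
    exact Fin.succ_ne_zero _ hp
  · rintro rfl
    exact Fin.succ_ne_zero _ hq

theorem tailBlocks_tailBlocks_comp_swap {k : ℕ} (s : Fin (k + 1 + 1) × Fin 2 → Fin n)
    {p q : Fin (k + 1 + 1) × Fin 2} (hp : p.1 ≤ 1) (hq : q.1 ≤ 1) :
    tailBlocks (tailBlocks (s ∘ Equiv.swap p q)) = tailBlocks (tailBlocks s) := by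
  funext r
  simp only [tailBlocks, Function.comp_apply]
  rw [Equiv.swap_apply_of_ne_of_ne]
  · rintro rfl
    simp [Fin.le_def] at hp
  · rintro rfl
    simp [Fin.le_def] at hq

theorem commute_pairProd {k : ℕ} {s : Fin k × Fin 2 → Fin n} {i j : Fin n}
    (hi : ∀ q, s q ≠ i) (hj : ∀ q, s q ≠ j) : Commute (eU n i j) (pairProd s) := by
  refine Commute.list_prod_right _ _ fun a ha => ?_
  obtain ⟨l, rfl⟩ := List.mem_ofFn.mp ha
  exact commute_eU (hi _).symm (hi _).symm (hj _).symm (hj _).symm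

/-- Different blocks carry disjoint labels, so their factors commute and the order of the product is
immaterial. -/
theorem pairProd_comp_blockPerm {k : ℕ} {s : Fin k × Fin 2 → Fin n} (hs : Function.Injective s)
    (β : Equiv.Perm (Fin k)) : pairProd (s ∘ blockPerm β) = pairProd s := by
  unfold pairProd
  refine List.Perm.prod_eq' (β.ofFn_comp_perm fun l => eU n (s (l, 0)) (s (l, 1))) ?_
  rw [List.pairwise_ofFn]
  intro i j hij
  have hne : β i ≠ β j := fun h => hij.ne (β.injective h)
  apply commute_eU <;> exact fun h => hne (congrArg Prod.fst (hs h))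

end PairProd


/-! ### Expansions of the Pfaffian along a row -/

section Expansion

variable {M : ℕ}

/-- The alternating sum of products of pairs in which the first block is removed and its labels are
`i` and `j`. -/
def minorSum (i j : Fin (2 * (M + 1))) : Uso (2 * (M + 1)) :=
  altSum fun s => if s (0, 0) = i ∧ s (0, 1) = j then pairProd (tailBlocks s) else 0

/-- The alternating sum over the labellings with first label `i`, in which this label is replaced
by `k` and the first pair is moved to the end. -/
def rowSum (i k : Fin (2 * (M + 1))) : Uso (2 * (M + 1)) :=
  altSum fun s => if s (0, 0) = i then pairProd (tailBlocks s) * eU _ k (s (0, 1)) else 0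

theorem minorSum_swap (i j : Fin (2 * (M + 1))) : minorSum j i = -minorSum i j := by
  unfold minorSum
  rw [← altSum_comp_swap (p := (0, 0)) (q := (0, 1)) (by simp)]
  refine altSum_congr fun s _ => ?_
  have ht := tailBlocks_comp_swap s (p := (0, 0)) (q := (0, 1)) rfl rfl
  simp only [Function.comp_apply, Equiv.swap_apply_left, Equiv.swap_apply_right, ht]
  simp only [and_comm]

theorem minorSum_self (i : Fin (2 * (M + 1))) : minorSum i i = 0 := by
  unfold minorSum
  refine altSum_eq_zero fun s hs => if_neg fun h => ?_
  simpa using hs.1 (h.1.trans h.2.symm)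

theorem sum_minorSum_mul (i k : Fin (2 * (M + 1))) :
    ∑ j, minorSum i j * eU _ k j = rowSum i k := by
  unfold minorSum rowSum
  simp only [← altSum_mul_right]
  rw [← altSum_sum]
  refine altSum_congr fun s _ => ?_
  by_cases h : s (0, 0) = i
  · simp [h]
  · simp [h]

/-- Expansion of the Pfaffian along the row `i`. -/
theorem altSum_pairProd (i : Fin (2 * (M + 1))) :
    altSum (fun s => pairProd s) = (2 * ((M + 1 : ℕ) : ℂ)) • rowSum i i := by
  have h0 : altSum (fun s => if s (0, 0) = i then pairProd s else 0) = rowSum i i := by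
    refine altSum_congr fun s hs => ?_
    split_ifs with h
    · rw [pairProd_succ, h, (commute_pairProd ?_ ?_).eq]
      · intro q hq
        simpa [Prod.ext_iff] using hs.1 (hq.trans h.symm)
      · intro q hq
        simpa [Prod.ext_iff] using hs.1 hq
    · rfl
  -- Exchanging the two positions of the block costs a sign in the alternating sum, and `e_{ba} =
  -- -e_{ab}` restores it.
  have h1 : altSum (fun s => if s (0, 1) = i then pairProd s else 0) = rowSum i i := by
    rw [← h0, ← neg_neg (altSum fun s => if s (0, 0) = i then pairProd s else 0),
      ← altSum_comp_swap (p := (0, 0)) (q := (0, 1)) (by simp), ← altSum_neg]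
    refine altSum_congr fun s _ => ?_
    have ht := tailBlocks_comp_swap s (p := (0, 0)) (q := (0, 1)) rfl rfl
    simp only [Function.comp_apply, Equiv.swap_apply_left, pairProd_succ, ht,
      Equiv.swap_apply_right]
    rw [eU_swap (s (0, 1)) (s (0, 0))]
    split_ifs <;> simp
  -- Block permutations make all blocks equivalent, so the `2(M + 1)` possible positions of `i`
  -- contribute equally; this is the constant of the expansion.
  have h2 : ∀ (l : Fin (M + 1)) (ε : Fin 2),
      altSum (fun s => if s (l, ε) = i then pairProd s else 0)
        = altSum (fun s => if s (0, ε) = i then pairProd s else 0) := by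
    intro l ε
    rw [← altSum_comp_blockPerm (Equiv.swap 0 l) fun s => if s (0, ε) = i then pairProd s else 0]
    refine altSum_congr fun s hs => ?_
    rw [pairProd_comp_blockPerm hs.1]
    simp
  rw [altSum_eq_sum_slots i, Fintype.sum_prod_type]
  simp only [h2, Fin.sum_univ_two, h0, h1, Finset.sum_const, Finset.card_univ, Fintype.card_fin]
  rw [← two_nsmul, smul_smul, ← Nat.cast_smul_eq_nsmul ℂ]
  push_cast
  ring_nf

/-- The part of `rowSum i k` in which `k` is the first label of the second block. -/
def crossSum (i k : Fin (2 * (M + 1 + 1))) : Uso (2 * (M + 1 + 1)) :=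
  altSum fun s => if s (0, 0) = i ∧ s (1, 0) = k then
    eU _ k (s (1, 1)) * eU _ k (s (0, 1)) * pairProd (tailBlocks (tailBlocks s)) else 0

/-- Exchanging the labels at `(0, 1)` and `(1, 1)` reverses the sign and the order of the two
factors containing `k`. Adding both forms produces their commutator, in which `k` has disappeared.
-/
theorem two_smul_crossSum (i k : Fin (2 * (M + 1 + 1))) :
    (2 : ℕ) • crossSum i k = altSum fun s => if s (0, 0) = i ∧ s (1, 0) = k then
      eU _ (s (1, 1)) (s (0, 1)) * pairProd (tailBlocks (tailBlocks s)) else 0 := by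
  have h1 : crossSum i k = -altSum fun s => if s (0, 0) = i ∧ s (1, 0) = k then
      eU _ k (s (0, 1)) * eU _ k (s (1, 1)) * pairProd (tailBlocks (tailBlocks s)) else 0 := by
    unfold crossSum
    rw [← altSum_comp_swap (p := (0, 1)) (q := (1, 1)) (by simp)]
    refine altSum_congr fun s _ => ?_
    have ht := tailBlocks_tailBlocks_comp_swap s (p := (0, 1)) (q := (1, 1)) (by simp) (by simp)
    simp only [Function.comp_apply, Equiv.swap_apply_left, ht, Equiv.swap_apply_right]
    rw [Equiv.swap_apply_of_ne_of_ne (by simp) (by simp),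
      Equiv.swap_apply_of_ne_of_ne (by simp) (by simp)]
  rw [two_nsmul]
  nth_rewrite 2 [h1]
  rw [crossSum, ← altSum_neg, ← altSum_add]
  refine altSum_congr fun s hs => ?_
  split_ifs with h
  · rw [← neg_mul, ← add_mul, ← sub_eq_add_neg, eU_commutator]
    · rw [← h.2]
      exact fun h' => by simpa using hs.1 h'
    · rw [← h.2]
      exact fun h' => by simpa using hs.1 h'
    · exact fun h' => by simpa using hs.1 h'
  · simp

/-- In the doubled form `i` and `k` occur only in the conditions on the positions `(0, 0)` and `(1,
0)`, which a transposition interchanges. -/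
theorem crossSum_swap (i k : Fin (2 * (M + 1 + 1))) :
    crossSum k i = -crossSum i k := by
  have h : (2 : ℕ) • crossSum k i = (2 : ℕ) • -crossSum i k := by
    rw [smul_neg, two_smul_crossSum, two_smul_crossSum,
      ← altSum_comp_swap (p := (0, 0)) (q := (1, 0)) (by simp)]
    refine altSum_congr fun s _ => ?_
    have ht := tailBlocks_tailBlocks_comp_swap s (p := (0, 0)) (q := (1, 0)) (by simp) (by simp)
    simp only [Function.comp_apply, Equiv.swap_apply_left, ht, Equiv.swap_apply_right]
    rw [Equiv.swap_apply_of_ne_of_ne (by simp) (by simp),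
      Equiv.swap_apply_of_ne_of_ne (by simp) (by simp)]
    simp only [and_comm]
  rw [← Nat.cast_smul_eq_nsmul ℂ, ← Nat.cast_smul_eq_nsmul ℂ] at h
  exact smul_right_injective _ (by norm_num) h

/-- The sum is split by the position of the label `k`. In the first block it contributes nothing:
`(0, 0)` holds `i`, and at `(0, 1)` it gives `e_{kk} = 0`. The other `2(M + 1)` positions contribute
equally. -/
theorem rowSum_eq_crossSum {i k : Fin (2 * (M + 1 + 1))} (hik : i ≠ k) :
    rowSum i k = (2 * (M + 1)) • crossSum i k := by
  set f : (Fin (M + 1 + 1) × Fin 2 → Fin (2 * (M + 1 + 1))) → Uso (2 * (M + 1 + 1)) :=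
    fun s => if s (0, 0) = i then pairProd (tailBlocks s) * eU _ k (s (0, 1)) else 0 with hf
  have hz : ∀ ε, altSum (fun s => if s (0, ε) = k then f s else 0) = 0 := by
    intro ε
    refine altSum_eq_zero fun s _ => ?_
    simp only [hf]
    fin_cases ε
    · split_ifs with h1 h2
      · exact absurd (h2.symm.trans h1) hik
      · rfl
      · rfl
    · split_ifs with h1 h2
      · simp only [Fin.mk_one] at h1
        rw [h1, eU_self, mul_zero]
      · rfl
      · rfl
  have h0 : altSum (fun s => if s (1, 0) = k then f s else 0) = crossSum i k := by
    refine altSum_congr fun s hs => ?_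
    simp only [hf]
    by_cases h1 : s (1, 0) = k
    · by_cases h2 : s (0, 0) = i
      · simp only [h1, h2, and_self, if_true]
        -- The last factor `e_{k,s(0,1)}` moves left past the blocks from the third on, which
        -- contain neither of its labels; it stops behind the second block, with which it shares
        -- `k`.
        rw [pairProd_succ, mul_assoc, mul_assoc, (commute_pairProd ?_ ?_).eq]
        · have ht : ∀ ε, tailBlocks s (0, ε) = s (1, ε) := fun _ => rfl
          rw [ht, ht, h1]
        · intro q hq
          have h3 : q.1.succ.succ = 1 := congrArg Prod.fst (hs.1 (hq.trans h1.symm))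
          simp [Fin.ext_iff] at h3
        · intro q hq
          simpa [Prod.ext_iff] using hs.1 hq
      · simp [h2]
    · simp [h1]
  have h1 : altSum (fun s => if s (1, 1) = k then f s else 0) = crossSum i k := by
    rw [← h0, ← neg_neg (altSum fun s => if s (1, 0) = k then f s else 0),
      ← altSum_comp_swap (p := (1, 0)) (q := (1, 1)) (by simp), ← altSum_neg]
    refine altSum_congr fun s _ => ?_
    have ht := tailBlocks_tailBlocks_comp_swap s (p := (1, 0)) (q := (1, 1)) (by simp) (by simp)
    simp only [hf, Function.comp_apply, Equiv.swap_apply_left, pairProd_succ, ht]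
    simp only [tailBlocks, Fin.succ_zero_eq_one, Function.comp_apply, Equiv.swap_apply_left,
      Equiv.swap_apply_right]
    rw [Equiv.swap_apply_of_ne_of_ne (by simp) (by simp),
      Equiv.swap_apply_of_ne_of_ne (by simp) (by simp), eU_swap (s (1, 1)) (s (1, 0))]
    split_ifs <;> simp
  have h2 : ∀ (l : Fin (M + 1)) (ε : Fin 2),
      altSum (fun s => if s (l.succ, ε) = k then f s else 0)
        = altSum (fun s => if s (1, ε) = k then f s else 0) := by
    intro l ε
    -- This block permutation fixes block `0` and exchanges the blocks `1` and `l + 1`.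
    rw [← altSum_comp_blockPerm (Equiv.Perm.decomposeFin.symm (0, Equiv.swap 0 l))
      fun s => if s (1, ε) = k then f s else 0]
    refine altSum_congr fun s hs => ?_
    have ht : tailBlocks (s ∘ blockPerm (Equiv.Perm.decomposeFin.symm (0, Equiv.swap 0 l)))
        = tailBlocks s ∘ blockPerm (Equiv.swap 0 l) := by
      funext q
      simp [tailBlocks]
    simp only [hf, ht, pairProd_comp_blockPerm (tailBlocks_injective hs.1)]
    have h3 : blockPerm (Equiv.Perm.decomposeFin.symm (0, Equiv.swap 0 l)) (1, ε)
        = (l.succ, ε) := by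
      simp
    have h4 : ∀ ε', blockPerm (Equiv.Perm.decomposeFin.symm (0, Equiv.swap 0 l)) (0, ε')
        = (0, ε') := by
      simp
    simp only [Function.comp_apply, h3, h4]
  rw [rowSum, ← hf, altSum_eq_sum_slots k, Fintype.sum_prod_type, Fin.sum_univ_succ]
  simp only [h2, hz, Fin.sum_univ_two, h0, h1, Finset.sum_const, Finset.card_univ,
    Fintype.card_fin, ← two_nsmul, smul_smul]
  rw [smul_zero, zero_add, mul_comm 2 (M + 1)]

theorem rowSum_swap {i k : Fin (2 * (M + 1))} (hik : i ≠ k) : rowSum k i = -rowSum i k := by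
  cases M with
  | zero =>
    -- In dimension two there is no second block: `k` must be the label at `(0, 1)`, and `e_{kk} =
    -- 0`.
    have h0 : ∀ {i k : Fin (2 * (0 + 1))}, i ≠ k → rowSum i k = 0 := by
      intro i k hik
      unfold rowSum
      refine altSum_eq_zero fun s hs => ?_
      split_ifs with h
      · obtain ⟨⟨l, ε⟩, rfl⟩ := hs.2 k
        obtain rfl : l = 0 := Fin.fin_one_eq_zero l
        fin_cases ε
        · exact absurd h.symm hik
        · simp [eU_self]
      · rfl
    rw [h0 hik, h0 hik.symm, neg_zero]
  | succ M => rw [rowSum_eq_crossSum hik, rowSum_eq_crossSum hik.symm, crossSum_swap, smul_neg]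

end Expansion


/-! ### The elements `pf_{ij}` as alternating sums -/

section Minors

variable {M : ℕ}

/-- The shuffle that lists `i`, `j` and then the rest in increasing order is a product of two
cycles, of signs `(-1)^i` and `(-1)^(j-1)`; the second exponent is the rank of `j` once `i` is
removed. -/
theorem exists_perm_of_lt {N : ℕ} {i j : Fin (N + 2)} (h : i < j) :
    ∃ σ : Equiv.Perm (Fin (N + 2)), σ 0 = i ∧ σ 1 = j ∧
      StrictMono (fun t : Fin N => σ t.succ.succ) ∧
      ((Equiv.Perm.sign σ : ℤ) : ℂ) = -(-1) ^ ((i : ℕ) + (j : ℕ)) := by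
  have hj : j ≠ 0 := Fin.ne_of_gt (Fin.lt_of_le_of_lt i.zero_le h)
  have h1 : ∀ t : Fin N, (i.cycleRange.symm * Equiv.Perm.decomposeFin.symm
      (0, (j.pred hj).cycleRange.symm)) t.succ.succ
        = i.succAbove ((j.pred hj).succAbove t) := by
    intro t
    rw [Equiv.Perm.mul_apply, Equiv.Perm.decomposeFin_symm_apply_succ, Fin.cycleRange_symm_succ]
    simp
  refine ⟨i.cycleRange.symm * Equiv.Perm.decomposeFin.symm (0, (j.pred hj).cycleRange.symm),
    ?_, ?_, ?_, ?_⟩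
  · simp
  · rw [Equiv.Perm.mul_apply, Equiv.Perm.decomposeFin_symm_apply_one, Fin.cycleRange_symm_zero]
    simp only [Equiv.swap_self, Equiv.refl_apply, Fin.cycleRange_symm_succ]
    exact Fin.succAbove_pred_of_lt i j h
  · simp only [h1]
    exact (Fin.strictMono_succAbove i).comp (Fin.strictMono_succAbove _)
  · obtain ⟨k, hk⟩ : ∃ k, (j : ℕ) = k + 1 := ⟨(j : ℕ) - 1, by omega⟩
    simp only [Equiv.Perm.sign_mul, Equiv.Perm.decomposeFin.symm_sign, Equiv.Perm.sign_symm,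
      Fin.sign_cycleRange, Fin.val_pred, hk]
    simp
    ring

theorem range_restEnum {i j : Fin (2 * (M + 1))} (h : i ≠ j) :
    Set.range (fun t => (restEnum h t : Fin (2 * (M + 1)))) = {l | l ≠ i ∧ l ≠ j} := by
  ext l
  constructor
  · rintro ⟨t, rfl⟩
    exact (restEnum h t).2
  · intro hl
    exact ⟨(restEnum h).symm ⟨l, hl⟩, by simp⟩

theorem exists_perm_restEnum {i j : Fin (2 * (M + 1))} (h : i < j) :
    ∃ σ : Equiv.Perm (Fin (2 * (M + 1))), σ (slotEquiv _ (0, 0)) = i ∧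
      σ (slotEquiv _ (0, 1)) = j ∧
      (∀ q : Fin M × Fin 2, σ (slotEquiv _ (q.1.succ, q.2)) = restEnum h.ne (slotEquiv M q)) ∧
      ((Equiv.Perm.sign σ : ℤ) : ℂ) = -(-1) ^ ((i : ℕ) + (j : ℕ)) := by
  obtain ⟨σ, h0, h1, hm, hs⟩ := exists_perm_of_lt (N := 2 * M) (i := i) (j := j) h
  refine ⟨σ, h0, h1, ?_, hs⟩
  have hr : Set.range (fun t : Fin (2 * M) => σ t.succ.succ) = {l | l ≠ i ∧ l ≠ j} := by
    ext l
    constructor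
    · rintro ⟨t, rfl⟩
      refine ⟨fun h' => ?_, fun h' => ?_⟩
      · rw [← h0] at h'
        simpa using σ.injective h'
      · rw [← h1] at h'
        simpa [Fin.ext_iff] using σ.injective h'
    · rintro ⟨hi, hj⟩
      obtain ⟨t, rfl⟩ := σ.surjective l
      have ht0 : t ≠ 0 := fun h' => hi (by rw [h', h0])
      have ht1 : t ≠ 1 := fun h' => hj (by rw [h', h1])
      refine ⟨⟨(t : ℕ) - 2, by omega⟩, ?_⟩
      simp only
      congr 1
      ext
      have h0' : (t : ℕ) ≠ 0 := fun h' => ht0 (Fin.ext h')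
      have h1' : (t : ℕ) ≠ 1 := fun h' => ht1 (Fin.ext h')
      simp only [Fin.val_succ]
      omega
  have hrest : StrictMono (fun t : Fin (2 * M) => (restEnum h.ne t : Fin (2 * (M + 1)))) :=
    fun a b hab => (restEnum h.ne).strictMono hab
  -- Two strictly increasing enumerations of the same set coincide.
  have := (hm.range_inj hrest).1 (hr.trans (range_restEnum h.ne).symm)
  intro q
  rw [← congrFun this (slotEquiv M q)]
  rfl

/-- Writing each labelling as `τ * σ₀` with the shuffle `σ₀`, the condition on the first block says
that `τ` fixes `i` and `j`, so `τ` is a permutation of the remaining indices. The sign of `σ₀`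
becomes the prefactor; starting indices at `0` does not change the parity of `i + j`. -/
theorem minorSum_eq {i j : Fin (2 * (M + 1))} (h : i < j) :
    minorSum i j = (-(-1 : ℂ) ^ ((i : ℕ) + (j : ℕ))) •
      ∑ τ : Equiv.Perm (Rest i j), ((Equiv.Perm.sign τ : ℤ) : ℂ) •
        pairProd fun q : Fin M × Fin 2 => (τ (restEnum h.ne (slotEquiv M q)) : Fin _) := by
  obtain ⟨σ₀, h0, h1, hr, hs⟩ := exists_perm_restEnum h
  have hfix : ∀ {τ : Equiv.Perm (Fin (2 * (M + 1)))},
      (τ i = i ∧ τ j = j) ↔ ∀ a, ¬(a ≠ i ∧ a ≠ j) → τ a = a := by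
    intro τ
    constructor
    · rintro ⟨hi, hj⟩ a ha
      by_cases hai : a = i
      · rw [hai, hi]
      · by_cases haj : a = j
        · rw [haj, hj]
        · exact absurd ⟨hai, haj⟩ ha
    · intro ha
      exact ⟨ha i (by simp), ha j (by simp)⟩
  have key : ∀ τ : Equiv.Perm (Fin (2 * (M + 1))),
      ((Equiv.Perm.sign (τ * σ₀) : ℤ) : ℂ) •
        (if (τ * σ₀) (slotEquiv _ (0, 0)) = i ∧ (τ * σ₀) (slotEquiv _ (0, 1)) = j then
          pairProd (tailBlocks ((τ * σ₀) ∘ slotEquiv _)) else 0)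
      = (-(-1 : ℂ) ^ ((i : ℕ) + (j : ℕ))) • if τ i = i ∧ τ j = j then
          ((Equiv.Perm.sign τ : ℤ) : ℂ) • pairProd (fun q : Fin M × Fin 2 =>
            τ (restEnum h.ne (slotEquiv M q))) else 0 := by
    intro τ
    have ht : tailBlocks ((τ * σ₀) ∘ slotEquiv _)
        = fun q : Fin M × Fin 2 => τ (restEnum h.ne (slotEquiv M q)) := by
      funext q
      simp [tailBlocks, hr]
    rw [Equiv.Perm.mul_apply, Equiv.Perm.mul_apply, h0, h1, ht, Equiv.Perm.sign_mul,
      Units.val_mul, Int.cast_mul, hs]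
    split_ifs
    · rw [smul_smul]
      congr 1
      exact mul_comm _ _
    · simp
  unfold minorSum altSum
  rw [← Equiv.sum_comp (Equiv.mulRight σ₀)]
  refine (Finset.sum_congr rfl fun τ _ => key τ).trans ?_
  rw [← Finset.smul_sum]
  congr 1
  rw [← Finset.sum_filter, Finset.sum_subtype (p := fun τ : Equiv.Perm (Fin (2 * (M + 1))) =>
    ∀ a, ¬(a ≠ i ∧ a ≠ j) → τ a = a) _ (by
      intro τ
      rw [Finset.mem_filter_univ, hfix])]
  refine (Fintype.sum_equiv (Equiv.Perm.subtypeEquivSubtypePerm fun a => a ≠ i ∧ a ≠ j) _ _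
    fun τ => ?_).symm
  have hsgn : Equiv.Perm.sign (Equiv.Perm.subtypeEquivSubtypePerm
      (fun a => a ≠ i ∧ a ≠ j) τ).1 = Equiv.Perm.sign τ := Equiv.Perm.sign_ofSubtype τ
  rw [hsgn]
  congr 2
  funext q
  exact (Equiv.Perm.subtypeEquivSubtypePerm_apply_of_mem τ (restEnum h.ne (slotEquiv M q)).2).symm

/-- The constant in the definition of the Pfaffian. -/
noncomputable def pfConst (m : ℕ) : ℂ := 1 / (Complex.I ^ m * 2 ^ m * (m.factorial : ℂ))

theorem pf_eq (m : ℕ) : pf m = pfConst m • altSum fun s => pairProd s := by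
  simp only [pf, pfConst, altSum, pairProd, Function.comp_apply, slotEquiv_zero, slotEquiv_one]

theorem pfAux_eq {i j : Fin (2 * (M + 1))} (h : i < j) :
    pfAux (M + 1) h.ne = (-(pfConst (M + 1) * (2 * ((M + 1 : ℕ) : ℂ)))) • minorSum i j := by
  rw [minorSum_eq h, smul_smul]
  unfold pfAux
  congr 1
  · rw [pfConst]
    ring
  · refine Finset.sum_congr rfl fun τ _ => ?_
    congr 1
    simp only [pairProd, slotEquiv_zero, slotEquiv_one]
    rfl

theorem pfIJ_of_ne {i j : Fin (2 * (M + 1))} (h : i ≠ j) :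
    pfIJ (M + 1) i j = (-(pfConst (M + 1) * (2 * ((M + 1 : ℕ) : ℂ)))) • minorSum i j := by
  unfold pfIJ
  rw [dif_neg h]
  split_ifs with hlt
  · exact pfAux_eq hlt
  · have hlt' : j < i := lt_of_le_of_ne (not_lt.mp hlt) h.symm
    rw [pfAux_eq hlt', minorSum_swap i j, smul_neg, neg_neg]

/-- `pf_{ij}` for `i ≠ j`, and zero on the diagonal. -/
noncomputable def pfOff (m : ℕ) (i j : Fin (2 * m)) : Uso (2 * m) :=
  if i = j then 0 else pfIJ m i j

theorem pfOff_eq (i j : Fin (2 * (M + 1))) :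
    pfOff (M + 1) i j = (-(pfConst (M + 1) * (2 * ((M + 1 : ℕ) : ℂ)))) • minorSum i j := by
  unfold pfOff
  split_ifs with h
  · rw [← h, minorSum_self, smul_zero]
  · exact pfIJ_of_ne h

theorem pfOff_swap {m : ℕ} (i j : Fin (2 * m)) : pfOff m j i = -pfOff m i j := by
  obtain _ | M := m
  · exact i.elim0
  · rw [pfOff_eq, pfOff_eq, minorSum_swap i j, smul_neg]

/-- `∑_j pf_{ij} e_{kj}`, summed over `j ≠ i`. -/
noncomputable def pfRow (m : ℕ) (i k : Fin (2 * m)) : Uso (2 * m) :=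
  ∑ j, pfOff m i j * eU _ k j

theorem pfRow_eq (i k : Fin (2 * (M + 1))) :
    pfRow (M + 1) i k = (-(pfConst (M + 1) * (2 * ((M + 1 : ℕ) : ℂ)))) • rowSum i k := by
  rw [← sum_minorSum_mul, Finset.smul_sum]
  refine Finset.sum_congr rfl fun j _ => ?_
  rw [pfOff_eq, smul_mul_assoc]

/-- The factor `2m` in `pf_{ij}` matches the count in the row expansion; the minus sign comes from
the sign of the shuffle. -/
theorem pfRow_self {m : ℕ} (i : Fin (2 * m)) : pfRow m i i = -pf m := by
  obtain _ | M := m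
  · exact i.elim0
  · rw [pfRow_eq, pf_eq, altSum_pairProd i, smul_smul, neg_smul]

theorem pfRow_swap {m : ℕ} {i k : Fin (2 * m)} (h : i ≠ k) : pfRow m k i = -pfRow m i k := by
  obtain _ | M := m
  · exact i.elim0
  · rw [pfRow_eq, pfRow_eq, rowSum_swap h, smul_neg]

end Minors

/-! ### Contractions with curvature-like tensors -/

section Contractions

variable {m : ℕ}

theorem pfContract_add (A B : Fin (2 * m) → Fin (2 * m) → Fin (2 * m) → Fin (2 * m) → ℝ) :
    pfContract m (fun i j k l => A i j k l + B i j k l) = pfContract m A + pfContract m B := by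
  simp only [pfContract, Complex.ofReal_add, add_smul, Finset.sum_add_distrib, smul_add]

/-- The convention `pf_{ii} = pf` plays no role for such tensors, so the skew-symmetric family
`pfOff` may be used. -/
theorem pfContract_eq (A : Fin (2 * m) → Fin (2 * m) → Fin (2 * m) → Fin (2 * m) → ℝ)
    (hA : ∀ i k l, A i i k l = 0) :
    pfContract m A = (1 / 2 : ℂ) • ∑ i, ∑ j, ∑ k, ∑ l, ((A i j k l : ℝ) : ℂ) •
      (pfOff m i j * eU (2 * m) k l) := by
  unfold pfContract
  congr 1
  refine Finset.sum_congr rfl fun i _ => Finset.sum_congr rfl fun j _ =>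
    Finset.sum_congr rfl fun k _ => Finset.sum_congr rfl fun l _ => ?_
  by_cases h : i = j
  · subst h
    rw [hA, Complex.ofReal_zero, zero_smul, zero_smul]
  · rw [pfOff, if_neg h]

theorem kd_comm {n : ℕ} (i j : Fin n) : kd i j = kd j i := by simp [kd, eq_comm]

theorem ofReal_mul_kd_smul {n : ℕ} {A : Type*} [AddCommGroup A] [Module ℂ A] (c : ℝ) (i j : Fin n)
    (a : A) : ((c * kd i j : ℝ) : ℂ) • a = if i = j then (c : ℂ) • a else 0 := by
  unfold kd
  split_ifs <;> simp

/-- Adding the sum to its transpose cancels the off-diagonal terms and leaves `-2 tr(E) pf`. -/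
theorem sum_smul_pfRow (E : Fin (2 * m) → Fin (2 * m) → ℝ) (hE : ∀ i j, E i j = E j i)
    (htr : ∑ i, E i i = 0) : ∑ i, ∑ k, (E i k : ℂ) • pfRow m i k = 0 := by
  have h1 : ∀ i k, (E i k : ℂ) • pfRow m i k + (E k i : ℂ) • pfRow m k i
      = -if i = k then (2 * E i i : ℂ) • pf m else 0 := by
    intro i k
    split_ifs with h
    · rw [← h, pfRow_self, ← two_smul ℂ, smul_smul, smul_neg]
    · rw [hE k i, pfRow_swap h, smul_neg, add_neg_cancel, neg_zero]
  have h2 : (2 : ℂ) • ∑ i, ∑ k, (E i k : ℂ) • pfRow m i k = 0 := by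
    rw [two_smul]
    nth_rewrite 2 [Finset.sum_comm]
    simp only [← Finset.sum_add_distrib, h1, Finset.sum_neg_distrib, Finset.sum_ite_eq,
      Finset.mem_univ, if_true, ← Finset.sum_smul, ← Finset.mul_sum]
    rw [← Complex.ofReal_sum, htr]
    simp
  exact (smul_eq_zero.mp h2).resolve_left two_ne_zero

theorem sum_einstein {n : ℕ} (R : Fin n → Fin n → Fin n → Fin n → ℝ) : ∑ i, einstein R i i = 0 := by
  obtain _ | n := n
  · simp
  · simp only [einstein, kd, if_true, ← Finset.mul_sum, Finset.sum_sub_distrib, Finset.sum_const,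
      Finset.card_univ, Fintype.card_fin, nsmul_eq_mul, mul_one]
    -- The trace of the bracket vanishes, so the prefactor, which is `0` for `n = 2`, does not
    -- matter.
    rw [mul_div_cancel₀ _ (by positivity), ← scal, sub_self, mul_zero]

/-- The contraction with the part of a curvature tensor that comes from the Einstein tensor
vanishes. -/
theorem pfContract_einsteinPart (R : Fin (2 * m) → Fin (2 * m) → Fin (2 * m) → Fin (2 * m) → ℝ)
    (hR : ∀ i j, ricci R i j = ricci R j i) : pfContract m (einsteinPart R) = 0 := by
  have hE : ∀ i j, einstein R i j = einstein R j i := by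
    intro i j
    simp only [einstein, hR i j, kd_comm i j]
  -- The skew-symmetries of `pfOff` and `eU` absorb the signs in `K`; after relabelling, all four
  -- terms have the same sum `∑ E_{ik} P_{ik}`.
  have h4 : ∀ i j k l, ((einsteinPart R i j k l : ℝ) : ℂ) • (pfOff m i j * eU (2 * m) k l)
      = (if j = l then (einstein R i k : ℂ) • (pfOff m i j * eU (2 * m) k l) else 0)
        + (if i = k then (einstein R j l : ℂ) • (pfOff m j i * eU (2 * m) l k) else 0)
        + (if j = k then (einstein R i l : ℂ) • (pfOff m i j * eU (2 * m) l k) else 0)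
        + (if i = l then (einstein R j k : ℂ) • (pfOff m j i * eU (2 * m) k l) else 0) := by
    intro i j k l
    rw [pfOff_swap i j, eU_swap k l]
    simp only [einsteinPart, sub_eq_add_neg, Complex.ofReal_add, Complex.ofReal_neg, add_smul,
      neg_smul, ofReal_mul_kd_smul, neg_mul, mul_neg, neg_neg, smul_neg]
    split_ifs <;> simp
  rw [pfContract_eq _ fun i k l => by simp only [einsteinPart]; ring]
  have e1 : (∑ i, ∑ j, ∑ k, ∑ l,
      (if j = l then (einstein R i k : ℂ) • (pfOff m i j * eU (2 * m) k l) else 0)) = 0 := by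
    refine Eq.trans ?_ (sum_smul_pfRow (einstein R) hE (sum_einstein R))
    refine Finset.sum_congr rfl fun i _ => ?_
    rw [Finset.sum_comm]
    simp [pfRow, Finset.smul_sum]
  have e2 : (∑ i, ∑ j, ∑ k, ∑ l,
      (if i = k then (einstein R j l : ℂ) • (pfOff m j i * eU (2 * m) l k) else 0)) = 0 := by
    refine Eq.trans ?_ e1
    rw [Finset.sum_comm]
    refine Finset.sum_congr rfl fun j _ => Finset.sum_congr rfl fun i _ => Finset.sum_comm
  have e3 : (∑ i, ∑ j, ∑ k, ∑ l,
      (if j = k then (einstein R i l : ℂ) • (pfOff m i j * eU (2 * m) l k) else 0)) = 0 := by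
    refine Eq.trans ?_ e1
    refine Finset.sum_congr rfl fun j _ => Finset.sum_congr rfl fun i _ => Finset.sum_comm
  have e4 : (∑ i, ∑ j, ∑ k, ∑ l,
      (if i = l then (einstein R j k : ℂ) • (pfOff m j i * eU (2 * m) k l) else 0)) = 0 := by
    refine Eq.trans ?_ e1
    rw [Finset.sum_comm]
  simp only [h4, Finset.sum_add_distrib, e1, e2, e3, e4, add_zero, smul_zero]

/-- Both delta terms collapse to `-c ∑_i P_{ii} = c n pf` with `c = κ / (n(n-1))`, and the factor
`½` compensates for their number. -/
theorem pfContract_scalPart (hm : 1 ≤ m)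
    (R : Fin (2 * m) → Fin (2 * m) → Fin (2 * m) → Fin (2 * m) → ℝ) :
    pfContract m (scalPart R)
      = ((scal R / (((2 * m : ℕ) : ℝ) - 1) : ℝ) : ℂ) • pf m := by
  set c : ℝ := scal R / (((2 * m : ℕ) : ℝ) * (((2 * m : ℕ) : ℝ) - 1)) with hc
  have h4 : ∀ i j k l, ((scalPart R i j k l : ℝ) : ℂ) • (pfOff m i j * eU (2 * m) k l)
      = -((if i = l then if j = k then (c : ℂ) • (pfOff m i j * eU (2 * m) l k) else 0 else 0)
        + (if j = l then if i = k then (c : ℂ) • (pfOff m i j * eU (2 * m) k l) else 0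
          else 0)) := by
    intro i j k l
    rw [eU_swap k l]
    simp only [scalPart, ← hc, kd]
    split_ifs <;> simp
  rw [pfContract_eq _ fun i k l => by simp only [scalPart, kd]; split_ifs <;> simp]
  simp only [h4, Finset.sum_neg_distrib, Finset.sum_add_distrib, Finset.sum_ite_eq,
    Finset.mem_univ, if_true]
  have hrow : ∑ i, ∑ j, (c : ℂ) • (pfOff m i j * eU (2 * m) i j)
      = -((c * ((2 * m : ℕ) : ℝ) : ℝ) : ℂ) • pf m := by
    have h : ∀ i, ∑ j, pfOff m i j * eU (2 * m) i j = -pf m := fun i => pfRow_self i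
    simp only [← Finset.smul_sum, h, Finset.sum_const, Finset.card_univ, Fintype.card_fin]
    rw [← Nat.cast_smul_eq_nsmul ℂ, smul_smul, smul_neg, neg_smul]
    push_cast
    rfl
  have hcn : c * ((2 * m : ℕ) : ℝ) = scal R / (((2 * m : ℕ) : ℝ) - 1) := by
    have h0 : ((2 * m : ℕ) : ℝ) ≠ 0 := by
      have : 2 * m ≠ 0 := by omega
      exact_mod_cast this
    rw [hc, div_mul_eq_mul_div, mul_comm (scal R), mul_div_mul_left _ _ h0]
  rw [hrow, ← two_smul ℂ, hcn, smul_neg, smul_smul, ← smul_neg]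
  norm_num

end Contractions


/-! ### Derivatives along smooth vector fields -/

section VectorFields

open VectorField Filter Topology

variable {n : ℕ} {M : Type*} [TopologicalSpace M] [ChartedSpace (EuclideanSpace ℝ (Fin n)) M]
  [IsManifold (𝓡 n) ∞ M] {F : Type*} [NormedAddCommGroup F] [NormedSpace ℝ F]
  {G : Type*} [NormedAddCommGroup G] [NormedSpace ℝ G]
  {U : Set M} {X Y Z : Π x : M, TangentSpace (𝓡 n) x} {x : M}

theorem SmoothFieldOn.contMDiffAt (hX : SmoothFieldOn X U) (hU : IsOpen U) (hx : x ∈ U) :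
    ContMDiffAt (𝓡 n) (𝓡 n).tangent ∞ (fun x => (⟨x, X x⟩ : TangentBundle (𝓡 n) M)) x :=
  (hX x hx).contMDiffAt (hU.mem_nhds hx)

theorem SmoothFieldOn.mdifferentiableAt (hX : SmoothFieldOn X U) (hU : IsOpen U) (hx : x ∈ U) :
    MDifferentiableAt (𝓡 n) (𝓡 n).tangent (fun x => (⟨x, X x⟩ : TangentBundle (𝓡 n) M)) x :=
  (hX.contMDiffAt hU hx).mdifferentiableAt (by simp)

theorem mdifferentiableAt_of_contMDiffOn {f : M → F} (hf : ContMDiffOn (𝓡 n) 𝓘(ℝ, F) ∞ f U)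
    (hU : IsOpen U) (hx : x ∈ U) : MDifferentiableAt (𝓡 n) 𝓘(ℝ, F) f x :=
  ((hf x hx).contMDiffAt (hU.mem_nhds hx)).mdifferentiableAt (by simp)

theorem contMDiffOn_mvfderiv_apply {f : M → F} (hf : ContMDiffOn (𝓡 n) 𝓘(ℝ, F) ∞ f U)
    (hU : IsOpen U) (hX : SmoothFieldOn X U) :
    ContMDiffOn (𝓡 n) 𝓘(ℝ, F) ∞ (fun y => mvfderiv (𝓡 n) f y (X y)) U := by
  have h1 : ContMDiffOn (𝓡 n) 𝓘(ℝ, F).tangent ∞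
      (tangentMapWithin (𝓡 n) 𝓘(ℝ, F) f U ∘ fun x => (⟨x, X x⟩ : TangentBundle (𝓡 n) M)) U :=
    (hf.contMDiffOn_tangentMapWithin (m := ∞) (by simp) hU.uniqueMDiffOn).comp hX
      (fun y hy => hy)
  refine ((contMDiff_snd_tangentBundle_modelSpace F 𝓘(ℝ, F)).comp_contMDiffOn h1).congr ?_
  intro y hy
  change (mfderiv (𝓡 n) 𝓘(ℝ, F) f y (X y) : F) = mfderivWithin (𝓡 n) 𝓘(ℝ, F) f U y (X y)
  rw [mfderivWithin_of_isOpen hU hy]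

theorem mvfderiv_congr {f g : M → F} (h : f =ᶠ[𝓝 x] g) :
    mvfderiv (𝓡 n) f x = mvfderiv (𝓡 n) g x := by
  ext v
  have := h.mfderiv_eq (I := 𝓡 n) (I' := 𝓘(ℝ, F))
  simp only [mvfderiv]
  change (mfderiv (𝓡 n) 𝓘(ℝ, F) f x v : F) = mfderiv (𝓡 n) 𝓘(ℝ, F) g x v
  rw [this]
  rfl

theorem mvfderiv_clm_comp {f : M → F} (hf : MDifferentiableAt (𝓡 n) 𝓘(ℝ, F) f x) (L : F →L[ℝ] G)
    (v : TangentSpace (𝓡 n) x) :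
    mvfderiv (𝓡 n) (fun y => L (f y)) x v = L (mvfderiv (𝓡 n) f x v) := by
  have h : mfderiv (𝓡 n) 𝓘(ℝ, G) (L ∘ f) x = _ :=
    mfderiv_comp x (L.mdifferentiableAt) hf
  rw [ContinuousLinearMap.mfderiv_eq] at h
  change (mfderiv (𝓡 n) 𝓘(ℝ, G) (L ∘ f) x v : G) = L (mfderiv (𝓡 n) 𝓘(ℝ, F) f x v)
  rw [h]
  rfl

theorem SmoothFieldOn.smul {f : M → ℝ} (hf : ContMDiffOn (𝓡 n) 𝓘(ℝ, ℝ) ∞ f U)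
    (hX : SmoothFieldOn X U) : SmoothFieldOn (f • X) U :=
  ContMDiffOn.smul_section hf hX

theorem SmoothFieldOn.mlieBracket (hU : IsOpen U) (hX : SmoothFieldOn X U)
    (hY : SmoothFieldOn Y U) : SmoothFieldOn (mlieBracket (𝓡 n) X Y) U := by
  intro y hy
  refine ContMDiffAt.contMDiffWithinAt ?_
  have : IsManifold (𝓡 n) (((⊤ : ℕ∞) : ℕ∞ω) + 1) M := by simpa using ‹IsManifold (𝓡 n) ∞ M›
  have : IsManifold (𝓡 n) (minSmoothness ℝ 2) M :=
    IsManifold.of_le (n := ∞) (by simpa using ENat.LEInfty.out)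
  exact ContMDiffAt.mlieBracket_vectorField (m := ⊤) (n := ⊤) (hX.contMDiffAt hU hy)
    (hY.contMDiffAt hU hy) (by simp)

theorem leibniz_mlieBracket (hU : IsOpen U) (hx : x ∈ U) (hX : SmoothFieldOn X U)
    (hY : SmoothFieldOn Y U) (hZ : SmoothFieldOn Z U) :
    mlieBracket (𝓡 n) X (mlieBracket (𝓡 n) Y Z) x
      = mlieBracket (𝓡 n) (mlieBracket (𝓡 n) X Y) Z x
        + mlieBracket (𝓡 n) Y (mlieBracket (𝓡 n) X Z) x := by
  have : IsManifold (𝓡 n) (minSmoothness ℝ 3) M :=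
    IsManifold.of_le (n := ∞) (by simpa using ENat.LEInfty.out)
  have h2 : minSmoothness ℝ 2 ≤ ∞ := by simpa using ENat.LEInfty.out
  exact leibniz_identity_mlieBracket_apply ((hX.contMDiffAt hU hx).of_le h2)
    ((hY.contMDiffAt hU hx).of_le h2) ((hZ.contMDiffAt hU hx).of_le h2)

/-- This is the Jacobi identity for `X`, `Y`, `f • Z`, expanded by the Leibniz rule. After
subtraction of `f` times the identity for `X`, `Y`, `Z`, only multiples of `Z x` survive, and `Z x ≠
0` can be cancelled. -/
theorem mvfderiv_commutator_real {f : M → ℝ} (hf : ContMDiffOn (𝓡 n) 𝓘(ℝ, ℝ) ∞ f U)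
    (hU : IsOpen U) (hx : x ∈ U) (hX : SmoothFieldOn X U) (hY : SmoothFieldOn Y U)
    (hZ : SmoothFieldOn Z U) (hZx : Z x ≠ 0) :
    mvfderiv (𝓡 n) (fun y => mvfderiv (𝓡 n) f y (Y y)) x (X x)
        - mvfderiv (𝓡 n) (fun y => mvfderiv (𝓡 n) f y (X y)) x (Y x)
      = mvfderiv (𝓡 n) f x (mlieBracket (𝓡 n) X Y x) := by
  have key : ∀ {A B : Π x : M, TangentSpace (𝓡 n) x}, SmoothFieldOn A U → SmoothFieldOn B U →
      mlieBracket (𝓡 n) A (mlieBracket (𝓡 n) B (f • Z)) x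
        = mvfderiv (𝓡 n) (fun y => mvfderiv (𝓡 n) f y (B y)) x (A x) • Z x
          + mvfderiv (𝓡 n) f x (B x) • mlieBracket (𝓡 n) A Z x
          + (mvfderiv (𝓡 n) f x (A x) • mlieBracket (𝓡 n) B Z x
            + f x • mlieBracket (𝓡 n) A (mlieBracket (𝓡 n) B Z) x) := by
    intro A B hA hB
    have h1 : mlieBracket (𝓡 n) B (f • Z) =ᶠ[𝓝 x]
        (fun y => mvfderiv (𝓡 n) f y (B y)) • Z + f • mlieBracket (𝓡 n) B Z := by
      filter_upwards [hU.mem_nhds hx] with y hy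
      exact mlieBracket_smul_right (mdifferentiableAt_of_contMDiffOn hf hU hy)
        (hZ.mdifferentiableAt hU hy)
    have hg := contMDiffOn_mvfderiv_apply hf hU hB
    have h2 : mlieBracket (𝓡 n) A (mlieBracket (𝓡 n) B (f • Z)) x = _ :=
      Filter.EventuallyEq.mlieBracket_vectorField_eq EventuallyEq.rfl h1
    rw [h2, mlieBracket_add_right ((hZ.smul hg).mdifferentiableAt hU hx)
        (((hB.mlieBracket hU hZ).smul hf).mdifferentiableAt hU hx),
      mlieBracket_smul_right (mdifferentiableAt_of_contMDiffOn hg hU hx)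
        (hZ.mdifferentiableAt hU hx),
      mlieBracket_smul_right (mdifferentiableAt_of_contMDiffOn hf hU hx)
        ((hB.mlieBracket hU hZ).mdifferentiableAt hU hx)]
  have h1 := leibniz_mlieBracket hU hx hX hY (hZ.smul hf)
  rw [key hX hY, key hY hX, mlieBracket_smul_right (mdifferentiableAt_of_contMDiffOn hf hU hx)
    (hZ.mdifferentiableAt hU hx), leibniz_mlieBracket hU hx hX hY hZ] at h1
  refine smul_left_injective ℝ hZx ?_
  beta_reduce
  rw [← sub_eq_zero] at h1 ⊢
  rw [← h1]
  module

theorem mvfderiv_commutator {f : M → F} (hf : ContMDiffOn (𝓡 n) 𝓘(ℝ, F) ∞ f U)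
    (hU : IsOpen U) (hx : x ∈ U) (hX : SmoothFieldOn X U) (hY : SmoothFieldOn Y U)
    (hZ : SmoothFieldOn Z U) (hZx : Z x ≠ 0) :
    mvfderiv (𝓡 n) (fun y => mvfderiv (𝓡 n) f y (Y y)) x (X x)
        - mvfderiv (𝓡 n) (fun y => mvfderiv (𝓡 n) f y (X y)) x (Y x)
      = mvfderiv (𝓡 n) f x (mlieBracket (𝓡 n) X Y x) := by
  -- Continuous linear functionals separate points, which reduces the claim to real functions.
  refine (SeparatingDual.eq_iff_forall_dual_eq (R := ℝ)).mpr fun L => ?_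
  have hL : ContMDiffOn (𝓡 n) 𝓘(ℝ, ℝ) ∞ (fun y => L (f y)) U :=
    L.contMDiff.comp_contMDiffOn hf
  have h1 : ∀ {A B : Π x : M, TangentSpace (𝓡 n) x}, SmoothFieldOn B U →
      L (mvfderiv (𝓡 n) (fun y => mvfderiv (𝓡 n) f y (B y)) x (A x))
        = mvfderiv (𝓡 n) (fun y => mvfderiv (𝓡 n) (fun y => L (f y)) y (B y)) x (A x) := by
    intro A B hB
    rw [← mvfderiv_clm_comp (mdifferentiableAt_of_contMDiffOn
      (contMDiffOn_mvfderiv_apply hf hU hB) hU hx) L, mvfderiv_congr]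
    filter_upwards [hU.mem_nhds hx] with y hy
    exact (mvfderiv_clm_comp (mdifferentiableAt_of_contMDiffOn hf hU hy) L _).symm
  rw [map_sub, h1 hY, h1 hX, mvfderiv_commutator_real hL hU hx hX hY hZ hZx,
    mvfderiv_clm_comp (mdifferentiableAt_of_contMDiffOn hf hU hx)]

end VectorFields

/-! ### Covariant derivatives of local vector fields -/

section Cov

open Filter Topology

variable {n : ℕ} {M : Type*} [TopologicalSpace M] [T2Space M]
  [ChartedSpace (EuclideanSpace ℝ (Fin n)) M] [IsManifold (𝓡 n) ∞ M]
  {U : Set M} {X Y Z : Π x : M, TangentSpace (𝓡 n) x} {x : M}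
  {cov : CovariantDerivative (𝓡 n) (EuclideanSpace ℝ (Fin n))
      (fun x : M => TangentSpace (𝓡 n) x)}

/-- Smoothness of `cov` is applied to a global field: `Y` is multiplied by a bump function equal to
`1` near the point, which by locality leaves the covariant derivative there unchanged. -/
theorem smoothFieldOn_cov (hcov : cov.ContMDiffCovariantDerivative ∞) (hU : IsOpen U)
    (hX : SmoothFieldOn X U) (hY : SmoothFieldOn Y U) :
    SmoothFieldOn (fun y => cov Y y (X y)) U := by
  intro x hx
  refine ContMDiffAt.contMDiffWithinAt ?_
  obtain ⟨χ, -, hχ⟩ := (SmoothBumpFunction.nhds_basis_tsupport (I := 𝓡 n) x).mem_iff.mp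
    (hU.mem_nhds hx)
  have hχY : SmoothFieldOn ((χ : M → ℝ) • Y) Set.univ := by
    rw [SmoothFieldOn, contMDiffOn_univ]
    exact ContMDiffOn.smul_section_of_tsupport χ.contMDiff.contMDiffOn hU hχ hY
  have h1 := hcov.contMDiff.contMDiff (σ := (χ : M → ℝ) • Y) hχY
  have h2 := ContMDiffAt.clm_bundle_apply ((h1 x trivial).contMDiffAt univ_mem)
    (hX.contMDiffAt hU hx)
  refine h2.congr_of_eventuallyEq ?_
  filter_upwards [χ.eventuallyEq_one.eventuallyEq_nhds, hU.mem_nhds hx] with y hy hyU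
  have h3 : cov Y y = cov ((χ : M → ℝ) • Y) y := by
    refine cov.isCovariantDerivativeOn.congr_of_eventuallyEq (s := Set.univ)
      (hY.mdifferentiableAt hU hyU) (hχY.mdifferentiableAt isOpen_univ trivial) univ_mem ?_
    filter_upwards [hy] with z hz
    simp [hz]
  rw [h3]

end Cov


/-! ### Complex skew-symmetric matrices from real connection forms -/

section SkewMatrices

variable {n : ℕ}

/-- The element `½ ∑_{kl} a_{kl} e_{kl}` of `𝔰𝔬(n, ℂ)`. -/
noncomputable def soOf (a : Fin n → Fin n → ℝ) : soC n :=
  (1 / 2 : ℂ) • ∑ k, ∑ l, ((a k l : ℝ) : ℂ) • eLie n k l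

theorem soOf_add (a b : Fin n → Fin n → ℝ) :
    soOf (fun k l => a k l + b k l) = soOf a + soOf b := by
  simp only [soOf, Complex.ofReal_add, add_smul, Finset.sum_add_distrib, smul_add]

theorem soOf_sub (a b : Fin n → Fin n → ℝ) :
    soOf (fun k l => a k l - b k l) = soOf a - soOf b := by
  simp only [soOf, Complex.ofReal_sub, sub_smul, Finset.sum_sub_distrib, smul_sub]

theorem soOf_apply {a : Fin n → Fin n → ℝ} (ha : ∀ k l, a k l = -a l k) (p q : Fin n) :
    (soOf a).1 p q = (a q p : ℂ) := by
  have h1 : ∀ k l, (eLie n k l).1 p q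
      = (if l = p then if k = q then 1 else 0 else 0)
        - (if l = q then if k = p then 1 else 0 else 0) := by
    intro k l
    simp only [eLie, Matrix.single, Matrix.sub_apply, Matrix.of_apply, ite_and]
    congr 1
    split_ifs <;> rfl
  have h2 : (soOf a).1 p q = (1 / 2 : ℂ) * ∑ k, ∑ l, (a k l : ℂ) * (eLie n k l).1 p q := by
    change (Matrix.entryLinearMap ℂ ℂ p q ∘ₗ (soC n).toSubmodule.subtype) (soOf a) = _
    simp only [soOf, map_sum, map_smul]
    rfl
  rw [h2]
  simp only [h1, mul_sub, mul_ite, mul_one, mul_zero, Finset.sum_sub_distrib, Finset.sum_ite_eq',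
    Finset.mem_univ, if_true]
  rw [ha p q]
  push_cast
  ring

/-- By `soOf_apply`, `soOf a` is the transpose of `a`; transposition reverses products, so the
commutator corresponds to `ba - ab`. -/
theorem lie_soOf {a b : Fin n → Fin n → ℝ} (ha : ∀ k l, a k l = -a l k)
    (hb : ∀ k l, b k l = -b l k) :
    ⁅soOf a, soOf b⁆ = soOf fun k l => ∑ p, (b k p * a p l - a k p * b p l) := by
  apply Subtype.ext
  ext p q
  rw [LieSubalgebra.coe_bracket, LieRing.of_associative_ring_bracket, Matrix.sub_apply,
    Matrix.mul_apply, Matrix.mul_apply, soOf_apply]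
  · simp only [soOf_apply ha, soOf_apply hb]
    push_cast
    rw [← Finset.sum_sub_distrib]
    exact Finset.sum_congr rfl fun r _ => by ring
  · intro k l
    rw [← Finset.sum_neg_distrib]
    refine Finset.sum_congr rfl fun r _ => ?_
    rw [ha k r, ha r l, hb k r, hb r l]
    ring

theorem rep_soOf {V : Type*} [AddCommGroup V] [Module ℂ V] (ρ : soC n →ₗ⁅ℂ⁆ Module.End ℂ V)
    (a : Fin n → Fin n → ℝ) (v : V) :
    ρ (soOf a) v = (1 / 2 : ℂ) • ∑ k, ∑ l, ((a k l : ℝ) : ℂ) • ρ (eLie n k l) v := by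
  simp only [soOf, map_smul, map_sum, LinearMap.smul_apply, LinearMap.sum_apply]

theorem repU_eU {V : Type*} [AddCommGroup V] [Module ℂ V] (ρ : soC n →ₗ⁅ℂ⁆ Module.End ℂ V)
    (k l : Fin n) : repU ρ (eU n k l) = ρ (eLie n k l) := by
  rw [repU, eU, UniversalEnvelopingAlgebra.lift_ι_apply]

end SkewMatrices

/-! ### From curvature components to contractions in the enveloping algebra -/

section RepContract

variable {m : ℕ}

theorem sum_repU_pfIJ {V : Type*} [AddCommGroup V] [Module ℂ V]
    (ρ : soC (2 * m) →ₗ⁅ℂ⁆ Module.End ℂ V)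
    (R : Fin (2 * m) → Fin (2 * m) → Fin (2 * m) → Fin (2 * m) → ℝ) (v : V) :
    ∑ i, ∑ j, repU ρ (pfIJ m i j) (ρ (soOf (R i j)) v) = repU ρ (pfContract m R) v := by
  simp only [pfContract, rep_soOf, map_smul, map_sum, map_mul, repU_eU, LinearMap.smul_apply,
    LinearMap.sum_apply, Finset.smul_sum, Module.End.mul_apply]

/-- A tensor with the symmetries of a curvature tensor has a symmetric Ricci contraction. -/
theorem ricci_symm {n : ℕ} {R : Fin n → Fin n → Fin n → Fin n → ℝ}
    (h12 : ∀ i j k l, R i j k l = -R j i k l) (h34 : ∀ i j k l, R i j k l = -R i j l k)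
    (hB : ∀ i j k l, R i j k l + R j k i l + R k i j l = 0) (i j : Fin n) :
    ricci R i j = ricci R j i := by
  -- Pair symmetry is a linear combination of four Bianchi identities and the skew-symmetries.
  have hpair : ∀ i j k l, R i j k l = R k l i j := by
    intro i j k l
    linarith [hB i j k l, hB j k l i, hB k l i j, hB l i j k, h12 i j k l, h12 j k i l,
      h12 k i j l, h34 i j k l, h34 j k i l, h34 k i j l, h12 k l j i, h12 l j k i, h12 l i k j,
      h12 i k l j, h12 k l i j, h34 k l j i, h34 j k l i, h34 l j k i, h34 l i k j, h34 i k l j,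
      h12 i j l k, h12 j l i k, h34 i j l k, h34 j l i k, h34 l i j k, h12 l i j k]
  refine Finset.sum_congr rfl fun k _ => ?_
  rw [hpair, h12, h34, neg_neg]

/-- Contraction of the Pfaffian elements with a tensor that has the symmetries of a curvature
tensor. -/
theorem pfContract_eq_weyl (hm : 1 ≤ m)
    (R : Fin (2 * m) → Fin (2 * m) → Fin (2 * m) → Fin (2 * m) → ℝ)
    (hR : ∀ i j, ricci R i j = ricci R j i) :
    pfContract m R = pfContract m (weyl R)
      + ((scal R / (((2 * m : ℕ) : ℝ) - 1) : ℝ) : ℂ) • pf m := by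
  have h : R = fun i j k l => (weyl R i j k l + einsteinPart R i j k l) + scalPart R i j k l := by
    funext i j k l
    simp only [weyl]
    ring
  conv_lhs => rw [h, pfContract_add, pfContract_add (weyl R)]
  rw [pfContract_einsteinPart R hR, add_zero, pfContract_scalPart hm]

end RepContract


/-! ### Torsion-free connections and the Bianchi identity -/

section TorsionFree

open VectorField Filter Topology

variable {n : ℕ} {M : Type*} [TopologicalSpace M] [T2Space M]
  [ChartedSpace (EuclideanSpace ℝ (Fin n)) M] [IsManifold (𝓡 n) ∞ M]
  {cov : CovariantDerivative (𝓡 n) (EuclideanSpace ℝ (Fin n))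
      (fun x : M => TangentSpace (𝓡 n) x)}
  {U : Set M} {x : M} {X Y Z : Π x : M, TangentSpace (𝓡 n) x}

theorem cov_sub_cov_eq_mlieBracket (hcov : cov.torsion = 0) (hU : IsOpen U) (hx : x ∈ U)
    (hX : SmoothFieldOn X U) (hY : SmoothFieldOn Y U) :
    cov Y x (X x) - cov X x (Y x) = mlieBracket (𝓡 n) X Y x := by
  have : IsManifold (𝓡 n) 2 M := IsManifold.of_le (n := ∞) (by simpa using ENat.LEInfty.out)
  exact cov.torsion_eq_zero_iff.mp hcov (hX.mdifferentiableAt hU hx)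
    (hY.mdifferentiableAt hU hx)

/-- The first Bianchi identity. -/
theorem bianchi (hs : cov.ContMDiffCovariantDerivative ∞) (hcov : cov.torsion = 0)
    (hU : IsOpen U) (hx : x ∈ U) (hX : SmoothFieldOn X U) (hY : SmoothFieldOn Y U)
    (hZ : SmoothFieldOn Z U) :
    curvT cov X Y Z x + curvT cov Y Z X x + curvT cov Z X Y x = 0 := by
  -- Vanishing torsion turns iterated brackets into covariant derivatives; the Bianchi identity is
  -- then the Jacobi identity.
  have key : ∀ {A B C : Π x : M, TangentSpace (𝓡 n) x}, SmoothFieldOn A U → SmoothFieldOn B U →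
      SmoothFieldOn C U → mlieBracket (𝓡 n) A (mlieBracket (𝓡 n) B C) x
        = cov (fun y => cov C y (B y)) x (A x) - cov (fun y => cov B y (C y)) x (A x)
          - (cov A x (cov C x (B x)) - cov A x (cov B x (C x))) := by
    intro A B C hA hB hC
    have hBC := smoothFieldOn_cov hs hU hB hC
    have hCB := smoothFieldOn_cov hs hU hC hB
    have hbr : mlieBracket (𝓡 n) B C =ᶠ[𝓝 x]
        (fun y => cov C y (B y)) + (-1 : ℝ) • fun y => cov B y (C y) := by
      filter_upwards [hU.mem_nhds hx] with y hy
      rw [← cov_sub_cov_eq_mlieBracket hcov hU hy hB hC]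
      change _ = cov C y (B y) + (-1 : ℝ) • cov B y (C y)
      rw [neg_one_smul, sub_eq_add_neg]
    have h2 : mlieBracket (𝓡 n) A (mlieBracket (𝓡 n) B C) x = _ :=
      Filter.EventuallyEq.mlieBracket_vectorField_eq EventuallyEq.rfl hbr
    have h3 : SmoothFieldOn ((-1 : ℝ) • fun y => cov B y (C y)) U :=
      SmoothFieldOn.smul (f := fun _ => (-1 : ℝ)) contMDiffOn_const hCB
    rw [h2, mlieBracket_add_right (hBC.mdifferentiableAt hU hx) (h3.mdifferentiableAt hU hx),
      mlieBracket_const_smul_right (hCB.mdifferentiableAt hU hx),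
      ← cov_sub_cov_eq_mlieBracket hcov hU hx hA hBC,
      ← cov_sub_cov_eq_mlieBracket hcov hU hx hA hCB]
    module
  have h1 := leibniz_mlieBracket hU hx hX hY hZ
  have h2 : mlieBracket (𝓡 n) (mlieBracket (𝓡 n) X Y) Z x
      = -mlieBracket (𝓡 n) Z (mlieBracket (𝓡 n) X Y) x := mlieBracket_swap_apply
  have h3 : mlieBracket (𝓡 n) Y (mlieBracket (𝓡 n) X Z) x
      = -mlieBracket (𝓡 n) Y (mlieBracket (𝓡 n) Z X) x := by
    rw [key hY hX hZ, key hY hZ hX]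
    module
  rw [h2, h3, key hX hY hZ, key hZ hX hY, key hY hZ hX, ← sub_eq_zero] at h1
  rw [← h1]
  simp only [curvT, curv, nabla2]
  module

end TorsionFree

section FrameGeometry

open VectorField Filter Topology

variable {n : ℕ} {M : Type*} [TopologicalSpace M] [T2Space M]
  [ChartedSpace (EuclideanSpace ℝ (Fin n)) M] [IsManifold (𝓡 n) ∞ M]
  [RiemannianBundle (fun x : M => TangentSpace (𝓡 n) x)]
  [IsContMDiffRiemannianBundle (𝓡 n) ∞ (EuclideanSpace ℝ (Fin n))
    (fun x : M => TangentSpace (𝓡 n) x)]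
  {o : ∀ x : M, Orientation ℝ (TangentSpace (𝓡 n) x) (Fin n)}
  {cov : CovariantDerivative (𝓡 n) (EuclideanSpace ℝ (Fin n))
      (fun x : M => TangentSpace (𝓡 n) x)}
  {U : Set M} {e : ∀ x : M, OFrame o x} {x : M} {X Y Z : Π x : M, TangentSpace (𝓡 n) x}

/-! ### The connection and curvature forms of a frame -/

theorem IsLeviCivita.mvfderiv_inner (hcov : IsLeviCivita cov) (hU : IsOpen U) (hx : x ∈ U)
    (hX : SmoothFieldOn X U) (hY : SmoothFieldOn Y U) (v : TangentSpace (𝓡 n) x) :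
    mvfderiv (𝓡 n) (fun y => inner ℝ (X y) (Y y)) x v
      = inner ℝ (cov X x v) (Y x) + inner ℝ (X x) (cov Y x v) := by
  classical
  -- Only the value at `x` of the differentiating field counts, so a discontinuous extension of `v`
  -- suffices.
  have h := hcov.metric.mvfderiv_inner_eq (Function.update 0 x v) (hX.mdifferentiableAt hU hx)
    (hY.mdifferentiableAt hU hx)
  simpa using h

/-- The connection form `g(∇_v e_k, e_l)` of a frame. -/
noncomputable def frameForm (cov : CovariantDerivative (𝓡 n) (EuclideanSpace ℝ (Fin n))
      (fun x : M => TangentSpace (𝓡 n) x)) (e : ∀ x : M, OFrame o x) (x : M)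
    (v : TangentSpace (𝓡 n) x) (k l : Fin n) : ℝ :=
  inner ℝ (cov (vec e k) x v) (vec e l x)

theorem frameForm_skew (hcov : IsLeviCivita cov) (hU : IsOpen U) (he : IsLocalFrame e U)
    (hx : x ∈ U) (v : TangentSpace (𝓡 n) x) (k l : Fin n) :
    frameForm cov e x v k l = -frameForm cov e x v l k := by
  have h := hcov.mvfderiv_inner hU hx (he k) (he l) v
  have hc : (fun y => inner ℝ (vec e k y) (vec e l y))
      = fun _ : M => if k = l then (1 : ℝ) else 0 := by
    funext y
    exact orthonormal_iff_ite.mp (e y).basis.orthonormal k l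
  rw [hc, mvfderiv_const, real_inner_comm (cov (vec e l) x v)] at h
  unfold frameForm
  change (0 : ℝ) = _ at h
  linarith

theorem frameForm_sub (v w : TangentSpace (𝓡 n) x) (k l : Fin n) :
    frameForm cov e x (v - w) k l = frameForm cov e x v k l - frameForm cov e x w k l := by
  simp [frameForm, inner_sub_left]

theorem contMDiffOn_frameForm (hcov : IsLeviCivita cov) (hU : IsOpen U) (he : IsLocalFrame e U)
    (hX : SmoothFieldOn X U) (k l : Fin n) :
    ContMDiffOn (𝓡 n) 𝓘(ℝ, ℝ) ∞ (fun y => frameForm cov e y (X y) k l) U :=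
  ContMDiffOn.inner_bundle (smoothFieldOn_cov hcov.smooth hU hX (he k)) (he l)

/-- The function `g(∇_{e_j} e_k, e_l)` is differentiated along `e_i`, and the correction term is
expanded in the orthonormal frame. -/
theorem inner_cov_cov (hcov : IsLeviCivita cov) (hU : IsOpen U) (he : IsLocalFrame e U)
    (hx : x ∈ U) (i j k l : Fin n) :
    inner ℝ (cov (fun y => cov (vec e k) y (vec e j y)) x (vec e i x)) (vec e l x)
      = mvfderiv (𝓡 n) (fun y => frameForm cov e y (vec e j y) k l) x (vec e i x)
        - ∑ p, frameForm cov e x (vec e j x) k p * frameForm cov e x (vec e i x) l p := by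
  have h := hcov.mvfderiv_inner hU hx (smoothFieldOn_cov hcov.smooth hU (he j) (he k)) (he l)
    (vec e i x)
  have h2 := (e x).basis.sum_inner_mul_inner (cov (vec e k) x (vec e j x))
    (cov (vec e l) x (vec e i x))
  have h3 : ∀ p, inner ℝ ((e x).basis p) (cov (vec e l) x (vec e i x))
      = frameForm cov e x (vec e i x) l p := fun p => real_inner_comm _ _
  simp only [h3] at h2
  rw [eq_sub_iff_add_eq]
  exact (congrArg _ h2).trans h.symm

/-- Cartan's second structure equation in components. The Lie bracket enters because the torsion
vanishes, and the quadratic term has the form found in `lie_soOf`. -/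
theorem riem_eq (hcov : IsLeviCivita cov) (hU : IsOpen U) (he : IsLocalFrame e U)
    (hx : x ∈ U) (i j k l : Fin n) :
    riem cov e x i j k l
      = mvfderiv (𝓡 n) (fun y => frameForm cov e y (vec e j y) k l) x (vec e i x)
        - mvfderiv (𝓡 n) (fun y => frameForm cov e y (vec e i y) k l) x (vec e j x)
        + ∑ p, (frameForm cov e x (vec e j x) k p * frameForm cov e x (vec e i x) p l
          - frameForm cov e x (vec e i x) k p * frameForm cov e x (vec e j x) p l)
        - frameForm cov e x (mlieBracket (𝓡 n) (vec e i) (vec e j) x) k l := by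
  have hs := fun v k l => frameForm_skew (cov := cov) (e := e) hcov hU he hx v k l
  rw [← cov_sub_cov_eq_mlieBracket hcov.torsion_free hU hx (he i) (he j), frameForm_sub]
  simp only [riem, curvT, curv, nabla2, inner_sub_left, inner_cov_cov hcov hU he hx]
  rw [Finset.sum_sub_distrib]
  simp only [hs _ l, mul_neg, Finset.sum_neg_distrib]
  simp only [frameForm]
  ring

theorem riem_swap_left (i j k l : Fin n) : riem cov e x i j k l = -riem cov e x j i k l := by
  simp only [riem, curvT, curv, ← inner_neg_left, neg_sub]

theorem riem_swap_right (hcov : IsLeviCivita cov) (hU : IsOpen U) (he : IsLocalFrame e U)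
    (hx : x ∈ U) (i j k l : Fin n) : riem cov e x i j k l = -riem cov e x i j l k := by
  have hs := fun v k l => frameForm_skew (cov := cov) (e := e) hcov hU he hx v k l
  have hd : ∀ i j, mvfderiv (𝓡 n) (fun y => frameForm cov e y (vec e j y) k l) x (vec e i x)
      = -mvfderiv (𝓡 n) (fun y => frameForm cov e y (vec e j y) l k) x (vec e i x) := by
    intro i j
    rw [← neg_apply, ← mvfderiv_neg, mvfderiv_congr]
    filter_upwards [hU.mem_nhds hx] with y hy
    exact frameForm_skew hcov hU he hy _ k l
  rw [riem_eq hcov hU he hx, riem_eq hcov hU he hx, hd i j, hd j i, hs _ k l]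
  have h4 : ∑ p, (frameForm cov e x (vec e j x) k p * frameForm cov e x (vec e i x) p l
          - frameForm cov e x (vec e i x) k p * frameForm cov e x (vec e j x) p l)
      = -∑ p, (frameForm cov e x (vec e j x) l p * frameForm cov e x (vec e i x) p k
          - frameForm cov e x (vec e i x) l p * frameForm cov e x (vec e j x) p k) := by
    rw [← Finset.sum_neg_distrib]
    refine Finset.sum_congr rfl fun p _ => ?_
    rw [hs _ k p, hs _ p l, hs _ k p, hs _ p l]
    ring
  rw [h4]
  ring

theorem ricci_riem_symm (hcov : IsLeviCivita cov) (hU : IsOpen U) (he : IsLocalFrame e U)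
    (hx : x ∈ U) (i j : Fin n) : ricci (riem cov e x) i j = ricci (riem cov e x) j i := by
  refine ricci_symm riem_swap_left (riem_swap_right hcov hU he hx) (fun i j k l => ?_) i j
  simp only [riem, ← inner_add_left]
  rw [bianchi hcov.smooth hcov.torsion_free hU hx (he i) (he j) (he k), inner_zero_left]

end FrameGeometry


section LocalCurvature

open VectorField Filter Topology

variable {n : ℕ} {M : Type*} [TopologicalSpace M] [T2Space M]
  [ChartedSpace (EuclideanSpace ℝ (Fin n)) M] [IsManifold (𝓡 n) ∞ M]
  {V : Type*} [NormedAddCommGroup V] [NormedSpace ℂ V] [FiniteDimensional ℂ V]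
  {ρ : soC n →ₗ⁅ℂ⁆ Module.End ℂ V}
  {U : Set M} {x : M} {ψ : M → V} {b : M → Fin n → Fin n → ℝ}

/-! ### Derivatives of functions acted on by a connection form -/

theorem mvfderiv_sum {F : Type*} [NormedAddCommGroup F] [NormedSpace ℝ F] {κ : Type*}
    (t : Finset κ) {f : κ → M → F} (hf : ∀ k ∈ t, MDifferentiableAt (𝓡 n) 𝓘(ℝ, F) (f k) x)
    (v : TangentSpace (𝓡 n) x) :
    MDifferentiableAt (𝓡 n) 𝓘(ℝ, F) (fun y => ∑ k ∈ t, f k y) x ∧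
      mvfderiv (𝓡 n) (fun y => ∑ k ∈ t, f k y) x v = ∑ k ∈ t, mvfderiv (𝓡 n) (f k) x v := by
  classical
  induction t using Finset.induction_on with
  | empty =>
    simp only [Finset.sum_empty]
    exact ⟨mdifferentiableAt_const, by rw [mvfderiv_const]; rfl⟩
  | insert k t hk ih =>
    obtain ⟨h1, h2⟩ := ih fun k hk => hf k (Finset.mem_insert_of_mem hk)
    have h3 := hf k (Finset.mem_insert_self k t)
    simp only [Finset.sum_insert hk]
    exact ⟨h3.add h1, by rw [mvfderiv_fun_add h3 h1, ← h2]; rfl⟩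

/-- The action of `½ e_{kl}` as a continuous real-linear map. -/
noncomputable def halfAct (ρ : soC n →ₗ⁅ℂ⁆ Module.End ℂ V) (k l : Fin n) : V →L[ℝ] V :=
  (LinearMap.toContinuousLinearMap ((1 / 2 : ℂ) • ρ (eLie n k l))).restrictScalars ℝ

/-- A finite sum of real coefficients times fixed continuous linear maps, to which the product rule
applies. -/
theorem rep_soOf_eq (a : Fin n → Fin n → ℝ) (v : V) :
    ρ (soOf a) v = ∑ k, ∑ l, a k l • halfAct ρ k l v := by
  rw [rep_soOf, Finset.smul_sum]
  refine Finset.sum_congr rfl fun k _ => ?_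
  rw [Finset.smul_sum]
  refine Finset.sum_congr rfl fun l _ => ?_
  rw [smul_comm, Complex.coe_smul]
  rfl

theorem contMDiffOn_rep_soOf (hb : ∀ k l, ContMDiffOn (𝓡 n) 𝓘(ℝ, ℝ) ∞ (fun y => b y k l) U)
    (hψ : ContMDiffOn (𝓡 n) 𝓘(ℝ, V) ∞ ψ U) :
    ContMDiffOn (𝓡 n) 𝓘(ℝ, V) ∞ (fun y => ρ (soOf (b y)) (ψ y)) U := by
  simp only [rep_soOf_eq]
  exact contMDiffOn_finsetSum fun k _ => contMDiffOn_finsetSum fun l _ =>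
    (hb k l).smul ((halfAct ρ k l).contMDiff.comp_contMDiffOn hψ)

theorem mvfderiv_rep_soOf (hb : ∀ k l, MDifferentiableAt (𝓡 n) 𝓘(ℝ, ℝ) (fun y => b y k l) x)
    (hψ : MDifferentiableAt (𝓡 n) 𝓘(ℝ, V) ψ x) (v : TangentSpace (𝓡 n) x) :
    mvfderiv (𝓡 n) (fun y => ρ (soOf (b y)) (ψ y)) x v
      = ρ (soOf fun k l => mvfderiv (𝓡 n) (fun y => b y k l) x v) (ψ x)
        + ρ (soOf (b x)) (mvfderiv (𝓡 n) ψ x v) := by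
  have h0 : ∀ k l, MDifferentiableAt (𝓡 n) 𝓘(ℝ, V) (fun y => halfAct ρ k l (ψ y)) x :=
    fun k l => (halfAct ρ k l).mdifferentiableAt.comp x hψ
  have h1 : ∀ k l, MDifferentiableAt (𝓡 n) 𝓘(ℝ, V) (fun y => b y k l • halfAct ρ k l (ψ y)) x :=
    fun k l => (hb k l).smul (h0 k l)
  simp only [rep_soOf_eq]
  rw [(mvfderiv_sum _ (fun k _ => (mvfderiv_sum _ (fun l _ => h1 k l) v).1) v).2,
    ← Finset.sum_add_distrib]
  refine Finset.sum_congr rfl fun k _ => ?_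
  rw [(mvfderiv_sum _ (fun l _ => h1 k l) v).2, ← Finset.sum_add_distrib]
  refine Finset.sum_congr rfl fun l _ => ?_
  rw [mvfderiv_fun_smul (hb k l) (h0 k l), add_apply, smul_apply, mvfderiv_clm_comp hψ, add_comm]
  rfl

variable [RiemannianBundle (fun x : M => TangentSpace (𝓡 n) x)]
  [IsContMDiffRiemannianBundle (𝓡 n) ∞ (EuclideanSpace ℝ (Fin n))
    (fun x : M => TangentSpace (𝓡 n) x)]
  {o : ∀ x : M, Orientation ℝ (TangentSpace (𝓡 n) x) (Fin n)}
  {cov : CovariantDerivative (𝓡 n) (EuclideanSpace ℝ (Fin n))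
      (fun x : M => TangentSpace (𝓡 n) x)}
  {e : ∀ x : M, OFrame o x} {X Y : Π x : M, TangentSpace (𝓡 n) x}

/-! ### Curvature of the induced connection in a frame -/

theorem localConn_eq (ψ : M → V) (x : M) (v : TangentSpace (𝓡 n) x) :
    localConn cov e ρ ψ x v = mvfderiv (𝓡 n) ψ x v + ρ (soOf (frameForm cov e x v)) (ψ x) := by
  rw [rep_soOf]
  rfl

theorem localConn_congr {φ : M → V} (h : ψ =ᶠ[𝓝 x] φ) (v : TangentSpace (𝓡 n) x) :
    localConn cov e ρ ψ x v = localConn cov e ρ φ x v := by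
  rw [localConn_eq, localConn_eq, mvfderiv_congr h, h.eq_of_nhds]

theorem contMDiffOn_localConn (hcov : IsLeviCivita cov) (hU : IsOpen U) (he : IsLocalFrame e U)
    (hψ : ContMDiffOn (𝓡 n) 𝓘(ℝ, V) ∞ ψ U) (hX : SmoothFieldOn X U) :
    ContMDiffOn (𝓡 n) 𝓘(ℝ, V) ∞ (fun y => localConn cov e ρ ψ y (X y)) U := by
  simp only [localConn_eq]
  exact (contMDiffOn_mvfderiv_apply hψ hU hX).add
    (contMDiffOn_rep_soOf (fun k l => contMDiffOn_frameForm hcov hU he hX k l) hψ)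

theorem localConn_localConn (hcov : IsLeviCivita cov) (hU : IsOpen U) (he : IsLocalFrame e U)
    (hψ : ContMDiffOn (𝓡 n) 𝓘(ℝ, V) ∞ ψ U) (hx : x ∈ U) (hY : SmoothFieldOn Y U)
    (v : TangentSpace (𝓡 n) x) :
    localConn cov e ρ (fun y => localConn cov e ρ ψ y (Y y)) x v
      = mvfderiv (𝓡 n) (fun y => mvfderiv (𝓡 n) ψ y (Y y)) x v
        + ρ (soOf fun k l => mvfderiv (𝓡 n) (fun y => frameForm cov e y (Y y) k l) x v) (ψ x)
        + ρ (soOf (frameForm cov e x (Y x))) (mvfderiv (𝓡 n) ψ x v)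
        + ρ (soOf (frameForm cov e x v)) (mvfderiv (𝓡 n) ψ x (Y x))
        + ρ (soOf (frameForm cov e x v)) (ρ (soOf (frameForm cov e x (Y x))) (ψ x)) := by
  have h1 := contMDiffOn_mvfderiv_apply hψ hU hY
  have h2 := fun k l => contMDiffOn_frameForm hcov hU he hY k l
  have h3 : ContMDiffOn (𝓡 n) 𝓘(ℝ, V) ∞
    (fun y => ρ (soOf (frameForm cov e y (Y y))) (ψ y)) U := contMDiffOn_rep_soOf h2 hψ
  rw [localConn_eq]
  simp only [localConn_eq ψ]
  rw [mvfderiv_fun_add (mdifferentiableAt_of_contMDiffOn h1 hU hx)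
    (mdifferentiableAt_of_contMDiffOn h3 hU hx), add_apply,
    mvfderiv_rep_soOf (fun k l => mdifferentiableAt_of_contMDiffOn (h2 k l) hU hx)
      (mdifferentiableAt_of_contMDiffOn hψ hU hx), map_add]
  simp only [add_assoc]

/-- On antisymmetrizing the second derivative, the mixed first-order terms cancel, the second
derivatives of `ψ` give the derivative along the bracket, and the quadratic terms give a commutator.
What is left is `ρ` applied to the structure equation. -/
theorem curv_localConn (hcov : IsLeviCivita cov) (hU : IsOpen U) (he : IsLocalFrame e U)
    (hψ : ContMDiffOn (𝓡 n) 𝓘(ℝ, V) ∞ ψ U) (hx : x ∈ U) (i j : Fin n) :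
    curv (S := fun _ : M => V) cov (localConn cov e ρ) (vec e i) (vec e j) ψ x
      = ρ (soOf (riem cov e x i j)) (ψ x) := by
  have hne : vec e i x ≠ 0 := (e x).basis.orthonormal.ne_zero i
  -- The frame field `e_i` itself serves as the auxiliary nonvanishing field.
  have hcomm := mvfderiv_commutator hψ hU hx (he i) (he j) (he i) hne
  have hR : riem cov e x i j = fun k l =>
      (mvfderiv (𝓡 n) (fun y => frameForm cov e y (vec e j y) k l) x (vec e i x)
        - mvfderiv (𝓡 n) (fun y => frameForm cov e y (vec e i y) k l) x (vec e j x)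
        + ∑ p, (frameForm cov e x (vec e j x) k p * frameForm cov e x (vec e i x) p l
          - frameForm cov e x (vec e i x) k p * frameForm cov e x (vec e j x) p l))
        - frameForm cov e x (mlieBracket (𝓡 n) (vec e i) (vec e j) x) k l := by
    funext k l
    exact riem_eq hcov hU he hx i j k l
  have hlie : ρ ⁅soOf (frameForm cov e x (vec e i x)), soOf (frameForm cov e x (vec e j x))⁆ (ψ x)
      = ρ (soOf (frameForm cov e x (vec e i x))) (ρ (soOf (frameForm cov e x (vec e j x))) (ψ x))
        - ρ (soOf (frameForm cov e x (vec e j x)))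
          (ρ (soOf (frameForm cov e x (vec e i x))) (ψ x)) := by
    rw [LieHom.map_lie, LieRing.of_associative_ring_bracket]
    rfl
  have hbr : localConn cov e ρ ψ x (cov (vec e j) x (vec e i x))
        - localConn cov e ρ ψ x (cov (vec e i) x (vec e j x))
      = mvfderiv (𝓡 n) ψ x (mlieBracket (𝓡 n) (vec e i) (vec e j) x)
        + ρ (soOf (frameForm cov e x (mlieBracket (𝓡 n) (vec e i) (vec e j) x))) (ψ x) := by
    rw [← cov_sub_cov_eq_mlieBracket hcov.torsion_free hU hx (he i) (he j), map_sub]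
    rw [show frameForm cov e x (cov (vec e j) x (vec e i x) - cov (vec e i) x (vec e j x))
      = fun k l => frameForm cov e x (cov (vec e j) x (vec e i x)) k l
        - frameForm cov e x (cov (vec e i) x (vec e j x)) k l from
        funext fun k => funext fun l => frameForm_sub _ _ k l]
    rw [soOf_sub, map_sub, LinearMap.sub_apply, localConn_eq, localConn_eq]
    abel
  rw [hR, soOf_sub, soOf_add, soOf_sub,
    ← lie_soOf (frameForm_skew hcov hU he hx _) (frameForm_skew hcov hU he hx _)]
  simp only [map_sub, map_add, LinearMap.sub_apply, LinearMap.add_apply]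
  rw [hlie]
  simp only [curv, nabla2]
  rw [localConn_localConn hcov hU he hψ hx (he j), localConn_localConn hcov hU he hψ hx (he i)]
  rw [sub_eq_iff_eq_add] at hbr hcomm
  rw [hbr, hcomm]
  abel

end LocalCurvature


/-! ### Transfer to the associated bundle -/

section AssociatedBundle

open Filter Topology

variable {n : ℕ} {M : Type*} [TopologicalSpace M] [T2Space M]
  [ChartedSpace (EuclideanSpace ℝ (Fin n)) M] [IsManifold (𝓡 n) ∞ M]
  {V : Type*} [NormedAddCommGroup V] [NormedSpace ℂ V] [FiniteDimensional ℂ V]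
  {ρ : soC n →ₗ⁅ℂ⁆ Module.End ℂ V}
  [RiemannianBundle (fun x : M => TangentSpace (𝓡 n) x)]
  [IsContMDiffRiemannianBundle (𝓡 n) ∞ (EuclideanSpace ℝ (Fin n))
    (fun x : M => TangentSpace (𝓡 n) x)]
  {o : ∀ x : M, Orientation ℝ (TangentSpace (𝓡 n) x) (Fin n)}
  {cov : CovariantDerivative (𝓡 n) (EuclideanSpace ℝ (Fin n))
      (fun x : M => TangentSpace (𝓡 n) x)}
  {U : Set M} {e : ∀ x : M, OFrame o x} {x : M} {X Y : Π x : M, TangentSpace (𝓡 n) x}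
  {Φ : Representation ℂ (SOn n) V}
  {D : (Π x : M, Fibre o Φ x) → Π x : M, TangentSpace (𝓡 n) x → Fibre o Φ x}
  {σ : Π x : M, Fibre o Φ x}

theorem frameEquiv_act (a : Uso n) (f : Fibre o Φ x) :
    frameEquiv Φ (e x) (act Φ ρ e x a f) = repU ρ a (frameEquiv Φ (e x) f) := by
  simp [act, LinearEquiv.conj_apply]

/-- `D` is prescribed only on sections with differentiable coordinates. For the outer derivative
this holds because the coordinates of `∇_Y σ` agree near `x` with a smooth function. -/
theorem frameEquiv_nabla2 (hcov : IsLeviCivita cov) (hD : IsInducedConnection cov Φ ρ D)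
    (hU : IsOpen U) (he : IsLocalFrame e U)
    (hσ : ContMDiffOn (𝓡 n) 𝓘(ℝ, V) ∞ (coord Φ e σ) U) (hx : x ∈ U) (hY : SmoothFieldOn Y U) :
    frameEquiv Φ (e x) (nabla2 (S := fun y : M => Fibre o Φ y) cov D X Y σ x)
      = nabla2 (S := fun _ : M => V) cov (localConn cov e ρ) X Y (coord Φ e σ) x := by
  have h1 := contMDiffOn_localConn (ρ := ρ) hcov hU he hσ hY
  have h2 : coord Φ e (fun y => D σ y (Y y))
      =ᶠ[𝓝 x] fun y => localConn cov e ρ (coord Φ e σ) y (Y y) := by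
    filter_upwards [hU.mem_nhds hx] with y hy
    exact hD e U hU he σ y hy (mdifferentiableAt_of_contMDiffOn hσ hU hy) (Y y)
  have h3 := (mdifferentiableAt_of_contMDiffOn h1 hU hx).congr_of_eventuallyEq h2
  simp only [nabla2]
  rw [map_sub, hD e U hU he _ x hx h3, localConn_congr h2,
    hD e U hU he σ x hx (mdifferentiableAt_of_contMDiffOn hσ hU hx)]

theorem frameEquiv_curv (hcov : IsLeviCivita cov) (hD : IsInducedConnection cov Φ ρ D)
    (hU : IsOpen U) (he : IsLocalFrame e U)
    (hσ : ContMDiffOn (𝓡 n) 𝓘(ℝ, V) ∞ (coord Φ e σ) U) (hx : x ∈ U) (hX : SmoothFieldOn X U)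
    (hY : SmoothFieldOn Y U) :
    frameEquiv Φ (e x) (curv (S := fun y : M => Fibre o Φ y) cov D X Y σ x)
      = curv (S := fun _ : M => V) cov (localConn cov e ρ) X Y (coord Φ e σ) x := by
  rw [curv, map_sub, frameEquiv_nabla2 hcov hD hU he hσ hx hY,
    frameEquiv_nabla2 hcov hD hU he hσ hx hX, curv]

end AssociatedBundle

end PfaffianCurvature

/-! ### The formula for the Pfaffian curvature endomorphism -/

open PfaffianCurvature in
theorem proposition6p3 (m : ℕ) (hm : 1 ≤ m)
    -- an oriented Riemannian manifold of dimension `n = 2m`, with its Levi-Civita connection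
    {M : Type*} [TopologicalSpace M] [T2Space M]
    [ChartedSpace (EuclideanSpace ℝ (Fin (2 * m))) M] [IsManifold (𝓡 (2 * m)) ∞ M]
    [RiemannianBundle (fun x : M => TangentSpace (𝓡 (2 * m)) x)]
    [IsContMDiffRiemannianBundle (𝓡 (2 * m)) ∞ (EuclideanSpace ℝ (Fin (2 * m)))
      (fun x : M => TangentSpace (𝓡 (2 * m)) x)]
    (o : ∀ x : M, Orientation ℝ (TangentSpace (𝓡 (2 * m)) x) (Fin (2 * m)))
    (ho : IsManifoldOrientation o)
    (cov : CovariantDerivative (𝓡 (2 * m)) (EuclideanSpace ℝ (Fin (2 * m)))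
      (fun x : M => TangentSpace (𝓡 (2 * m)) x))
    (hcov : IsLeviCivita cov)
    -- a finite-dimensional complex representation of `𝔰𝔬(n)`, written `π_ρ` when it is irreducible
    -- with highest weight `ρ` (integral or half-integral)
    {V : Type*} [NormedAddCommGroup V] [NormedSpace ℂ V] [FiniteDimensional ℂ V]
    (ρ : soC (2 * m) →ₗ⁅ℂ⁆ Module.End ℂ V)
    -- a local oriented orthonormal frame on `U`
    (U : Set M) (hU : IsOpen U) (e : ∀ x : M, OFrame o x) (he : IsLocalFrame e U) :
    -- the part of `R^pf` that comes from the Einstein tensor vanishes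
    (∀ x ∈ U, repU ρ (pfContract m (einsteinPart (riem cov e x))) = 0) ∧
    -- the formula for `R^pf` in the trivialization given by `e`
    (∀ ψ : M → V, ContMDiffOn (𝓡 (2 * m)) 𝓘(ℝ, V) ∞ ψ U → ∀ x ∈ U,
      localRpf cov e ρ ψ x =
        repU ρ (pfContract m (weyl (riem cov e x))) (ψ x)
          + ((scal (riem cov e x) / (((2 * m : ℕ) : ℝ) - 1) : ℝ) : ℂ) • repU ρ (pf m) (ψ x)) ∧
    -- the formula for `R^pf` on the bundle `SO(M) ×_{SO(n)} V`, if `ρ` is the differential of a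
    -- representation `Φ` of `SO(n)`
    (∀ Φ : Representation ℂ (SOn (2 * m)) V, IsDifferential Φ ρ →
      ∀ D : (Π x : M, Fibre o Φ x) → Π x : M, TangentSpace (𝓡 (2 * m)) x → Fibre o Φ x,
        IsInducedConnection cov Φ ρ D →
      ∀ σ : Π x : M, Fibre o Φ x, ContMDiffOn (𝓡 (2 * m)) 𝓘(ℝ, V) ∞ (coord Φ e σ) U →
      ∀ x ∈ U,
        bundleRpf cov e Φ ρ D σ x =
          act Φ ρ e x (pfContract m (weyl (riem cov e x))) (σ x)
            + ((scal (riem cov e x) / (((2 * m : ℕ) : ℝ) - 1) : ℝ) : ℂ)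
              • act Φ ρ e x (pf m) (σ x)) := by
  have hric : ∀ x ∈ U, ∀ i j, ricci (riem cov e x) i j = ricci (riem cov e x) j i :=
    fun x hx => ricci_riem_symm hcov hU he hx
  have hlocal : ∀ ψ : M → V, ContMDiffOn (𝓡 (2 * m)) 𝓘(ℝ, V) ∞ ψ U → ∀ x ∈ U,
      localRpf cov e ρ ψ x =
        repU ρ (pfContract m (weyl (riem cov e x))) (ψ x)
          + ((scal (riem cov e x) / (((2 * m : ℕ) : ℝ) - 1) : ℝ) : ℂ) • repU ρ (pf m) (ψ x) := by
    intro ψ hψ x hx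
    rw [localRpf]
    simp only [curv_localConn hcov hU he hψ hx]
    rw [sum_repU_pfIJ, pfContract_eq_weyl hm _ (hric x hx), map_add, map_smul,
      LinearMap.add_apply, LinearMap.smul_apply]
  refine ⟨fun x hx => ?_, hlocal, ?_⟩
  · rw [pfContract_einsteinPart _ (hric x hx), map_zero]
  · intro Φ _ D hD σ hσ x hx
    -- Read through the frame, the bundle formula is the local formula for the coordinate function
    -- of `σ`.
    apply (frameEquiv Φ (e x)).injective
    simp only [bundleRpf, map_sum, map_add, map_smul, frameEquiv_act,
      frameEquiv_curv hcov hD hU he hσ hx (he _) (he _)]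
    exact hlocal (coord Φ e σ) hσ x hx
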